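/- Let $d\in\mathbb N$ and let $m=(m^{(n)})_{n\in\mathbb N_0}$ be a sequence such that each $m^{(n)}$ is a non-negative Radon measure on $\mathbb R^{dn}=(\mathbb R^d)^n$ (a Borel measure finite on compact sets), symmetric in its $n$ variables from $\mathbb R^d$. For each $n\ge 1$ let $k_2^{(n)},\tilde k_2^{(n)}\in C^\infty(\mathbb R^d)$ be such that $k_2^{(n)}(r)\ge 1$ for all $r\in\mathbb R^d$ and $$\tilde k_2^{(n)}(r)\ \ge\ \big|(D^\kappa k_2^{(n)})(r)\big|^2\qquad\text{for all } r\in\mathbb R^d \text{ and all multi-indices } \kappa \text{ with } |\kappa|\le \Big\lceil \tfrac{d+1}{2}\Big\rceil .$$ Suppose that $$\sum_{n=1}^{\infty}\frac{1}{\Big(\sup\limits_{\|z\|\le n}\ \sup\limits_{x\in[-1,1]^d}\sqrt{\tilde k_2^{(2n)}(z+x)}\Big)\ \sqrt[2n]{\displaystyle\int_{\mathbb R^{2nd}}\frac{m^{(2n)}(dr_1,\ldots,dr_{2n})}{\prod_{l=1}^{2n}k_2^{(2n)}(r_l)}}}=\infty$$ (a summand with denominator $0$ being $\infty$) and that $$\int_{\mathbb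 R^{2nd}}\frac{m^{(2n)}(dr_1,\ldots,dr_{2n})}{\prod_{l=1}^{2n}k_2^{(2n)}(r_l)}<\infty\qquad\text{for all } n\in\mathbb N_0 .$$ Then $m$ is a determining sequence, in the following sense. For $N\in\mathbb N_0$ let $\mathscr D(\mathbb R^N)$ be the space $C_c^\infty(\mathbb R^N)$ of real-valued test functions with the locally convex topology generated by all the norms $$\varphi\mapsto\Big(\sum_{|\beta|\le k_1}\int_{\mathbb R^N}|D^\beta\varphi(r)|^2\,k_2(r)\,dr\Big)^{1/2},\qquad k_1\in\mathbb N_0,\quad k_2\in C^\infty(\mathbb R^N),\quad k_2\ge 1,$$ and let $\mathscr D'(\mathbb R^N)$ be its topological dual. Each $m^{(n)}$, acting by $\langle f,m^{(n)}\rangle=\int f\,dm^{(n)}$, is a symmetric element of $\mathscr D'(\mathbb R^{dn})$, and there is a set $E\subset\mathscr D(\mathbb R^d)$ whose linear span is dense in $\mathscr D(\mathbb R^d)$ such that the numbers $$m_0:=\sqrt{|m^{(0)}|},\qquad m_n:=\sqrt{\sup_{f_1,\ldots,f_{2n}\in E}\big|\langle f_1\otimes\cdots\otimes f_{2n},\,m^{(2n)}\rangle\big|}\quad(n\ge1)$$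 are all finite and the class $C\{m_n\}$ is quasi-analytic. Here $C\{M_n\}$ is the set of all $f\in C^\infty(\mathbb R)$ for which there are constants $\beta_f,B_f>0$ with $\|D^nf\|_\infty\le \beta_f B_f^n M_n$ for all $n\in\mathbb N_0$, and it is quasi-analytic if the only $f\in C\{M_n\}$ with $(D^nf)(0)=0$ for all $n\in\mathbb N_0$ is $f=0$. -/

import Mathlib

open scoped ENNReal ContDiff

namespace MomentProblem

noncomputable section

/-! ### Partial derivatives on `ℝ^ι` -/

/-- The partial derivative `∂f/∂r_i` of a real function on `ℝ^ι`. -/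
def partialD {ι : Type} [Fintype ι] [DecidableEq ι] (i : ι) (f : EuclideanSpace ℝ ι → ℝ) :
    EuclideanSpace ℝ ι → ℝ :=
  fun x => fderiv ℝ f x (EuclideanSpace.single i 1)

/-- The partial derivative `D^β f = ∂^{|β|} f / ∏ ∂r_i^{β_i}` for a multi-index `β`.  It is only
applied to smooth functions, for which the order of the differentiations is irrelevant. -/
def multiD {ι : Type} [Fintype ι] [DecidableEq ι] (β : ι → ℕ) (f : EuclideanSpace ℝ ι → ℝ) :
    EuclideanSpace ℝ ι → ℝ :=
  (Finset.univ : Finset ι).toList.foldr (fun i g => (partialD i)^[β i] g) f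

/-- The finite set of multi-indices `β` with `|β| ≤ a`. -/
def multiIndices (ι : Type) [Fintype ι] [DecidableEq ι] (a : ℕ) : Finset (ι → ℕ) :=
  (Fintype.piFinset fun _ : ι => Finset.range (a + 1)).filter fun β => ∑ i, β i ≤ a

theorem mem_multiIndices {ι : Type} [Fintype ι] [DecidableEq ι] {a : ℕ} {β : ι → ℕ} :
    β ∈ multiIndices ι a ↔ ∑ i, β i ≤ a := by
  simp only [multiIndices, Finset.mem_filter, Fintype.mem_piFinset, Finset.mem_range,
    and_iff_right_iff_imp]
  intro h i
  have := Finset.single_le_sum (f := β) (fun _ _ => Nat.zero_le _) (Finset.mem_univ i)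
  omega

section
variable {ι : Type} [Fintype ι] [DecidableEq ι]

theorem contDiff_partialD (i : ι) {f : EuclideanSpace ℝ ι → ℝ} (hf : ContDiff ℝ ∞ f) :
    ContDiff ℝ ∞ (partialD i f) :=
  (hf.fderiv_right (m := ∞) (by simp)).clm_apply contDiff_const

theorem hasCompactSupport_partialD (i : ι) {f : EuclideanSpace ℝ ι → ℝ}
    (hf : HasCompactSupport f) : HasCompactSupport (partialD i f) :=
  hf.fderiv_apply (𝕜 := ℝ) (EuclideanSpace.single i 1)

theorem partialD_add (i : ι) {f g : EuclideanSpace ℝ ι → ℝ} (hf : ContDiff ℝ ∞ f)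
    (hg : ContDiff ℝ ∞ g) : partialD i (f + g) = partialD i f + partialD i g := by
  funext x
  have h1 := (hf.differentiable (by simp)) x
  have h2 := (hg.differentiable (by simp)) x
  simp [partialD, fderiv_add h1 h2]

theorem partialD_smul (i : ι) (c : ℝ) {f : EuclideanSpace ℝ ι → ℝ} (hf : ContDiff ℝ ∞ f) :
    partialD i (c • f) = c • partialD i f := by
  funext x
  have h1 := (hf.differentiable (by simp)) x
  simp [partialD, fderiv_const_smul h1 c]

theorem iterate_partialD_props (i : ι) (n : ℕ) :
    (∀ f : EuclideanSpace ℝ ι → ℝ, ContDiff ℝ ∞ f → ContDiff ℝ ∞ ((partialD i)^[n] f)) ∧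
    (∀ f : EuclideanSpace ℝ ι → ℝ, HasCompactSupport f →
      HasCompactSupport ((partialD i)^[n] f)) ∧
    (∀ f g : EuclideanSpace ℝ ι → ℝ, ContDiff ℝ ∞ f → ContDiff ℝ ∞ g →
      (partialD i)^[n] (f + g) = (partialD i)^[n] f + (partialD i)^[n] g) ∧
    (∀ (c : ℝ) (f : EuclideanSpace ℝ ι → ℝ), ContDiff ℝ ∞ f →
      (partialD i)^[n] (c • f) = c • (partialD i)^[n] f) := by
  induction n with
  | zero => simp
  | succ n ih =>
    obtain ⟨h1, h2, h3, h4⟩ := ih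
    simp only [Function.iterate_succ_apply']
    refine ⟨fun f hf => contDiff_partialD i (h1 f hf),
      fun f hf => hasCompactSupport_partialD i (h2 f hf), fun f g hf hg => ?_, fun c f hf => ?_⟩
    · rw [h3 f g hf hg, partialD_add i (h1 f hf) (h1 g hg)]
    · rw [h4 c f hf, partialD_smul i c (h1 f hf)]

theorem multiD_props (β : ι → ℕ) :
    (∀ f : EuclideanSpace ℝ ι → ℝ, ContDiff ℝ ∞ f → ContDiff ℝ ∞ (multiD β f)) ∧
    (∀ f : EuclideanSpace ℝ ι → ℝ, HasCompactSupport f → HasCompactSupport (multiD β f)) ∧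
    (∀ f g : EuclideanSpace ℝ ι → ℝ, ContDiff ℝ ∞ f → ContDiff ℝ ∞ g →
      multiD β (f + g) = multiD β f + multiD β g) ∧
    (∀ (c : ℝ) (f : EuclideanSpace ℝ ι → ℝ), ContDiff ℝ ∞ f →
      multiD β (c • f) = c • multiD β f) := by
  unfold multiD
  induction (Finset.univ : Finset ι).toList with
  | nil => simp
  | cons i l ih =>
    obtain ⟨h1, h2, h3, h4⟩ := ih
    obtain ⟨k1, k2, k3, k4⟩ := iterate_partialD_props i (β i)
    simp only [List.foldr_cons]
    refine ⟨fun f hf => k1 _ (h1 f hf), fun f hf => k2 _ (h2 f hf), fun f g hf hg => ?_,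
      fun c f hf => ?_⟩
    · rw [h3 f g hf hg, k3 _ _ (h1 f hf) (h1 g hg)]
    · rw [h4 c f hf, k4 c _ (h1 f hf)]

end

/-! ### The test function space `𝒟_proj(ℝ^ι)` -/

/-- The real-valued smooth compactly supported functions on `ℝ^ι`, as a space of functions. -/
def testSubmodule (ι : Type) [Fintype ι] : Submodule ℝ (EuclideanSpace ℝ ι → ℝ) where
  carrier := {f | ContDiff ℝ ∞ f ∧ HasCompactSupport f}
  zero_mem' := ⟨contDiff_const, HasCompactSupport.zero⟩
  add_mem' hf hg := ⟨hf.1.add hg.1, hf.2.add hg.2⟩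
  smul_mem' c _ hf := ⟨contDiff_const.smul hf.1, HasCompactSupport.smul_left (f := fun _ => c) hf.2⟩

/-- `C_c^∞(ℝ^ι)`.  This is a separate type, since its topology is not that of pointwise
convergence but the projective topology defined below. -/
def TestSpace (ι : Type) [Fintype ι] : Type := testSubmodule ι

instance (ι : Type) [Fintype ι] : AddCommGroup (TestSpace ι) :=
  inferInstanceAs (AddCommGroup (testSubmodule ι))

instance (ι : Type) [Fintype ι] : Module ℝ (TestSpace ι) :=
  inferInstanceAs (Module ℝ (testSubmodule ι))

instance (ι : Type) [Fintype ι] :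
    CoeFun (TestSpace ι) (fun _ => EuclideanSpace ℝ ι → ℝ) := ⟨fun f => f.1⟩

section
variable {ι : Type} [Fintype ι]

theorem TestSpace.contDiff (f : TestSpace ι) : ContDiff ℝ ∞ f := f.2.1

theorem TestSpace.hasCompactSupport (f : TestSpace ι) : HasCompactSupport f := f.2.2

theorem TestSpace.coe_add (f g : TestSpace ι) : ((f + g : TestSpace ι) : _ → ℝ) = f + g := rfl

theorem TestSpace.coe_smul (c : ℝ) (f : TestSpace ι) :
    ((c • f : TestSpace ι) : _ → ℝ) = c • (f : EuclideanSpace ℝ ι → ℝ) := rfl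

end

/-- The index set `I`: pairs `(k₁, k₂)` with `k₁ ∈ ℕ` and `k₂ : ℝ^ι → [1, ∞)` smooth. -/
structure SobolevIndex (ι : Type) [Fintype ι] where
  order : ℕ
  weight : EuclideanSpace ℝ ι → ℝ
  smooth : ContDiff ℝ ∞ weight
  one_le : ∀ r, 1 ≤ weight r

instance (ι : Type) [Fintype ι] : Nonempty (SobolevIndex ι) :=
  ⟨⟨0, fun _ => 1, contDiff_const, fun _ => le_rfl⟩⟩

/-- The weighted Sobolev norm of `W_2^{k₁}(ℝ^ι, k₂(r)dr)` on test functions. -/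
def sobolevNorm {ι : Type} [Fintype ι] [DecidableEq ι] (k : SobolevIndex ι)
    (φ : TestSpace ι) : ℝ :=
  Real.sqrt (∑ β ∈ multiIndices ι k.order, ∫ r, |multiD β φ r| ^ 2 * k.weight r)

section
variable {ι : Type} [Fintype ι] [DecidableEq ι]

theorem integrable_multiD_mul (k : SobolevIndex ι) (β : ι → ℕ) (f g : TestSpace ι) :
    MeasureTheory.Integrable (fun r => multiD β f r * multiD β g r * k.weight r) := by
  obtain ⟨h1, h2, -, -⟩ := multiD_props β
  refine Continuous.integrable_of_hasCompactSupport ?_ ?_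
  · exact (((h1 f f.contDiff).continuous).mul ((h1 g g.contDiff).continuous)).mul
      k.smooth.continuous
  · exact ((h2 f f.hasCompactSupport).mul_right).mul_right

/-- The (semidefinite) inner product that belongs to `sobolevNorm`. -/
@[reducible] def sobolevCore (k : SobolevIndex ι) :
    PreInnerProductSpace.Core ℝ (TestSpace ι) where
  inner f g := ∑ β ∈ multiIndices ι k.order, ∫ r, multiD β f r * multiD β g r * k.weight r
  conj_inner_symm f g := by
    simp only [conj_trivial]
    refine Finset.sum_congr rfl fun β _ => ?_
    congr 1; funext r; ring
  re_inner_nonneg f := by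
    refine Finset.sum_nonneg fun β _ => MeasureTheory.integral_nonneg fun r => ?_
    exact mul_nonneg (mul_self_nonneg _) (zero_le_one.trans (k.one_le r))
  add_left f g h := by
    rw [← Finset.sum_add_distrib]
    refine Finset.sum_congr rfl fun β _ => ?_
    rw [← MeasureTheory.integral_add (integrable_multiD_mul k β f h)
      (integrable_multiD_mul k β g h)]
    congr 1; funext r
    rw [TestSpace.coe_add, (multiD_props β).2.2.1 _ _ f.contDiff g.contDiff, Pi.add_apply]
    ring
  smul_left f g c := by
    rw [Finset.mul_sum]
    refine Finset.sum_congr rfl fun β _ => ?_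
    rw [← MeasureTheory.integral_const_mul]
    congr 1; funext r
    rw [TestSpace.coe_smul, (multiD_props β).2.2.2 _ _ f.contDiff]
    simp only [Pi.smul_apply, smul_eq_mul, conj_trivial]
    ring

theorem sobolevNorm_eq (k : SobolevIndex ι) (f : TestSpace ι) :
    sobolevNorm k f = Real.sqrt ((sobolevCore k).inner f f) := by
  simp only [sobolevNorm, sq_abs]
  simp only [sq]
  rfl

theorem sobolevNorm_add_le (k : SobolevIndex ι) (f g : TestSpace ι) :
    sobolevNorm k (f + g) ≤ sobolevNorm k f + sobolevNorm k g := by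
  let _ := @InnerProductSpace.Core.toSeminormedAddCommGroup ℝ _ _ _ _ (sobolevCore k)
  have h : ∀ f : TestSpace ι, sobolevNorm k f = ‖f‖ := fun f => sobolevNorm_eq k f
  rw [h, h, h]
  exact norm_add_le f g

theorem sobolevNorm_smul (k : SobolevIndex ι) (c : ℝ) (f : TestSpace ι) :
    sobolevNorm k (c • f) = ‖c‖ * sobolevNorm k f := by
  rw [Real.norm_eq_abs, ← Real.sqrt_sq_eq_abs, sobolevNorm, sobolevNorm,
    ← Real.sqrt_mul (sq_nonneg c), Finset.mul_sum]
  congr 1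
  refine Finset.sum_congr rfl fun β _ => ?_
  rw [← MeasureTheory.integral_const_mul]
  congr 1; funext r
  rw [TestSpace.coe_smul, (multiD_props β).2.2.2 _ _ f.contDiff]
  simp only [Pi.smul_apply, smul_eq_mul, sq_abs]
  ring

end

/-- The family, indexed by `I`, of the weighted Sobolev norms on `C_c^∞(ℝ^ι)`. -/
def sobolevFamily (ι : Type) [Fintype ι] [DecidableEq ι] :
    SeminormFamily ℝ (TestSpace ι) (SobolevIndex ι) :=
  fun k => Seminorm.of (sobolevNorm k) (sobolevNorm_add_le k) (sobolevNorm_smul k)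

/-- The projective topology `τ_proj` on `C_c^∞(ℝ^ι)`: the locally convex topology generated by
all the weighted Sobolev norms.  With it, `TestSpace ι` is `𝒟(ℝ^ι) = 𝒟_proj(ℝ^ι)`, and the
topological dual `𝒟'(ℝ^ι)` is `TestSpace ι →L[ℝ] ℝ`. -/
instance (ι : Type) [Fintype ι] [DecidableEq ι] : TopologicalSpace (TestSpace ι) :=
  (sobolevFamily ι).moduleFilterBasis.topology

/-! ### Functions of `n` variables in `ℝ^d`

The space `ℝ^{dn}` is `EuclideanSpace ℝ (Fin n × Fin d)`. -/

/-- The `l`-th variable `r_l ∈ ℝ^d` of `(r_1, …, r_n) ∈ ℝ^{dn}`. -/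
def block {n d : ℕ} (l : Fin n) (r : EuclideanSpace ℝ (Fin n × Fin d)) :
    EuclideanSpace ℝ (Fin d) :=
  WithLp.toLp 2 fun i => r (l, i)

/-- The permutation of the `n` variables of `ℝ^{dn}` induced by a permutation of `Fin n`. -/
def permuteVars {n : ℕ} (d : ℕ) (σ : Equiv.Perm (Fin n)) :
    EuclideanSpace ℝ (Fin n × Fin d) ≃ₗᵢ[ℝ] EuclideanSpace ℝ (Fin n × Fin d) :=
  LinearIsometryEquiv.piLpCongrLeft 2 ℝ ℝ (σ.prodCongr (Equiv.refl (Fin d)))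

theorem contDiff_block {n d : ℕ} (l : Fin n) :
    ContDiff ℝ ∞ (block l : EuclideanSpace ℝ (Fin n × Fin d) → EuclideanSpace ℝ (Fin d)) := by
  rw [contDiff_euclidean]
  intro i
  exact (contDiff_euclidean (n := ∞)
    (f := (id : EuclideanSpace ℝ (Fin n × Fin d) → _))).1 contDiff_id (l, i)

/-- The test function `f ∘ σ` obtained from `f` by permuting its `n` variables. -/
def TestSpace.permute {n d : ℕ} (σ : Equiv.Perm (Fin n)) (f : TestSpace (Fin n × Fin d)) :
    TestSpace (Fin n × Fin d) :=
  ⟨fun r => f (permuteVars d σ r),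
    f.contDiff.comp (permuteVars d σ).contDiff,
    f.hasCompactSupport.comp_homeomorph (permuteVars d σ).toHomeomorph⟩

theorem hasCompactSupport_tensor {n d : ℕ} (f : Fin n → TestSpace (Fin d)) :
    HasCompactSupport fun r : EuclideanSpace ℝ (Fin n × Fin d) => ∏ l, f l (block l r) := by
  let J : (Fin n → EuclideanSpace ℝ (Fin d)) → EuclideanSpace ℝ (Fin n × Fin d) :=
    fun v => WithLp.toLp 2 fun p => v p.1 p.2
  have hJ : Continuous J := by
    refine (PiLp.continuous_toLp 2 _).comp (continuous_pi fun p => ?_)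
    fun_prop
  have hK : IsCompact (J '' Set.univ.pi fun l => tsupport (f l)) :=
    (isCompact_univ_pi fun l => (f l).hasCompactSupport).image hJ
  refine HasCompactSupport.intro hK fun r hr => ?_
  by_contra h
  refine hr ⟨fun l => block l r, fun l _ => ?_, rfl⟩
  exact subset_tsupport _ (Finset.prod_ne_zero_iff.1 h l (Finset.mem_univ l))

/-- The tensor product `f_1 ⊗ ⋯ ⊗ f_n ∈ C_c^∞(ℝ^{dn})` of `f_1, …, f_n ∈ C_c^∞(ℝ^d)`. -/
def TestSpace.tensor {n d : ℕ} (f : Fin n → TestSpace (Fin d)) : TestSpace (Fin n × Fin d) :=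
  ⟨fun r => ∏ l, f l (block l r),
    contDiff_prod fun l _ => (f l).contDiff.comp (contDiff_block l),
    hasCompactSupport_tensor f⟩

/-! ### Quasi-analytic classes -/

/-- The class `C{M_n}`: the smooth functions on `ℝ` with `‖D^n f‖_∞ ≤ β B^n M_n` for all `n`. -/
def carlemanClass (M : ℕ → ℝ) : Set (ℝ → ℝ) :=
  {f | ContDiff ℝ ∞ f ∧ ∃ β > 0, ∃ B > 0, ∀ (n : ℕ) (x : ℝ),
    |iteratedDeriv n f x| ≤ β * B ^ n * M n}

/-- The class `C{M_n}` is quasi-analytic. -/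
def IsQuasiAnalytic (M : ℕ → ℝ) : Prop :=
  ∀ f ∈ carlemanClass M, (∀ n : ℕ, iteratedDeriv n f 0 = 0) → ∀ x, f x = 0

/-! ### Determining sequences -/

/-- `ℱ(𝒟'(ℝ^d))`: the sequences `(m^{(n)})` of symmetric functionals `m^{(n)} ∈ 𝒟'(ℝ^{dn})`. -/
structure DistSeq (d : ℕ) where
  toFun : (n : ℕ) → (TestSpace (Fin n × Fin d) →L[ℝ] ℝ)
  symm : ∀ (n : ℕ) (σ : Equiv.Perm (Fin n)) (f : TestSpace (Fin n × Fin d)),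
    toFun n (f.permute σ) = toFun n f

/-- `m_n = (sup_{f_1, …, f_{2n} ∈ E} |⟨f_1 ⊗ ⋯ ⊗ f_{2n}, m^{(2n)}⟩|)^{1/2} ∈ [0, ∞]`; for `n = 0`
this is `|m^{(0)}|^{1/2}`. -/
def DistSeq.growth {d : ℕ} (m : DistSeq d) (E : Set (TestSpace (Fin d))) (n : ℕ) : ℝ≥0∞ :=
  (⨆ (f : Fin (2 * n) → TestSpace (Fin d)) (_ : ∀ l, f l ∈ E),
    ENNReal.ofReal |m.toFun (2 * n) (TestSpace.tensor f)|) ^ (1 / 2 : ℝ)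

/-- `m` is determining: there is a total subset `E` of `𝒟(ℝ^d)` for which all the `m_n` are finite
and the class `C{m_n}` is quasi-analytic. -/
def DistSeq.IsDetermining {d : ℕ} (m : DistSeq d) : Prop :=
  ∃ E : Set (TestSpace (Fin d)),
    Dense (Submodule.span ℝ E : Set (TestSpace (Fin d))) ∧
    (∀ n, m.growth E n < ⊤) ∧
    IsQuasiAnalytic fun n => (m.growth E n).toReal

/-! ### Sequences of Radon measures and the weighted Carleman type condition -/

/-- `ℱ(ℛ(ℝ^d))`: the sequences `(m^{(n)})` of symmetric (non-negative) Radon measures `m^{(n)}` on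
`ℝ^{dn}`, that is, symmetric Borel measures that are finite on compact sets. -/
structure RadonSeq (d : ℕ) where
  toMeasure : (n : ℕ) → MeasureTheory.Measure (EuclideanSpace ℝ (Fin n × Fin d))
  finite_on_compacts : ∀ (n : ℕ) (K : Set (EuclideanSpace ℝ (Fin n × Fin d))),
    IsCompact K → toMeasure n K < ⊤
  symm : ∀ (n : ℕ) (σ : Equiv.Perm (Fin n)),
    (toMeasure n).map (permuteVars d σ) = toMeasure n

/-- `∫_{ℝ^{dn}} m^{(n)}(dr_1, …, dr_n) / ∏_{l=1}^n w(r_l) ∈ [0, ∞]`. -/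
def RadonSeq.weightedIntegral {d : ℕ} (m : RadonSeq d) (n : ℕ)
    (w : EuclideanSpace ℝ (Fin d) → ℝ) : ℝ≥0∞ :=
  ∫⁻ r, ENNReal.ofReal (1 / ∏ l : Fin n, w (block l r)) ∂(m.toMeasure n)

/-- `sup_{‖z‖ ≤ n} sup_{x ∈ [-1,1]^d} √(w(z + x)) ∈ [0, ∞]`. -/
def weightSup {d : ℕ} (n : ℕ) (w : EuclideanSpace ℝ (Fin d) → ℝ) : ℝ≥0∞ :=
  ⨆ (z : EuclideanSpace ℝ (Fin d)) (_ : ‖z‖ ≤ n) (x : EuclideanSpace ℝ (Fin d))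
    (_ : ∀ i, x i ∈ Set.Icc (-1 : ℝ) 1), ENNReal.ofReal (Real.sqrt (w (z + x)))

/-- `k n` (for `n ≥ 1`) are smooth weights `≥ 1` on `ℝ^d`, and `kt n` are smooth functions with
`kt n ≥ |D^κ (k n)|²` for all `|κ| ≤ ⌈(d+1)/2⌉`. -/
structure AdmissibleWeights {d : ℕ} (k kt : ℕ → EuclideanSpace ℝ (Fin d) → ℝ) : Prop where
  smooth : ∀ n ≥ 1, ContDiff ℝ ∞ (k n)
  one_le : ∀ n ≥ 1, ∀ r, 1 ≤ k n r
  smooth_tilde : ∀ n ≥ 1, ContDiff ℝ ∞ (kt n)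
  le_tilde : ∀ n ≥ 1, ∀ κ : Fin d → ℕ, ∑ i, κ i ≤ ⌈((d : ℝ) + 1) / 2⌉₊ →
    ∀ r, |multiD κ (k n) r| ^ 2 ≤ kt n r

/-- The divergence in the weighted Carleman type condition, with the index `2n` at both weights;
the summands with `n ≥ 1` lie in `[0, ∞]`, with `1 / 0 = ∞`. -/
def RadonSeq.WeightedCarleman {d : ℕ} (m : RadonSeq d)
    (k kt : ℕ → EuclideanSpace ℝ (Fin d) → ℝ) : Prop :=
  ∑' n : ℕ+, (weightSup n (kt (2 * n)) *
    m.weightedIntegral (2 * n) (k (2 * n)) ^ (1 / (2 * (n : ℝ))))⁻¹ = ⊤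

/-- The functionals `T^{(n)} ∈ 𝒟'(ℝ^{dn})` are the Radon measures `m^{(n)}`, i.e.
`⟨f, T^{(n)}⟩ = ∫ f dm^{(n)}` for every test function `f`. -/
def DistSeq.IsGivenBy {d : ℕ} (T : DistSeq d) (m : RadonSeq d) : Prop :=
  ∀ (n : ℕ) (f : TestSpace (Fin n × Fin d)), T.toFun n f = ∫ r, f r ∂(m.toMeasure n)

end

end MomentProblem

namespace MomentProblem

/-! ### Carleman's inequality and quasi-analyticity -/

/-! Write `S_n` for the supremum of `√k̃^{(2n)}` in the Carleman condition. Take for `E` the test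
functions `f` with `|f| k^{(2n)} ≤ S_n` everywhere, for all `n ≥ 1`. Some nonzero multiple of every
test function lies in `E`: once the ball of radius `n` contains the support, `k ≤ √k̃` (the case `κ
= 0`) makes the constraint follow from `|f| ≤ 1`, and the finitely many remaining `n` are met by
scaling. So `E` spans the whole space (`span_dominatedTestFunctions`).

For `f_l ∈ E` the product `|f_1 ⊗ ⋯ ⊗ f_{2n}|` is at most `S_n^{2n} / ∏ k^{(2n)}(r_l)`. Integration
gives `m_n^{1/n} ≤ S_n (∫ dm^{(2n)} / ∏ k^{(2n)})^{1/(2n)}` (`growth_dominatedTestFunctions_le`),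
hence `∑ m_n^{-1/n} = ∞`.

Quasi-analyticity is then the Denjoy–Carleman theorem (`denjoy_carleman`) for a sequence that need
not be log-convex. It is proved by Bang's method, applied to the Newton polygon of `log M_n`;
Carleman's inequality transfers the divergence to the slopes of the polygon.

That a Radon measure is a continuous functional follows from a weighted Sobolev embedding
(`exists_mul_enorm_le_sobolevNorm`), with a radial weight `G` chosen so that `1 / G(‖x‖)` is
integrable for the measure. -/

theorem geometric_mean_le {a : ℕ → ℝ} (ha : ∀ j, 0 ≤ a j) (n : ℕ) :
    (∏ j ∈ Finset.range (n + 1), a j) ^ (1 / ((n : ℝ) + 1)) ≤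
      Real.exp 1 / ((n : ℝ) + 1) ^ 2 * ∑ j ∈ Finset.range (n + 1), ((j : ℝ) + 1) * a j := by
  have hn : (0 : ℝ) < (n : ℝ) + 1 := by positivity
  -- AM-GM is applied to `(j+1) a_j`, not `a_j`: the extracted factor `((n+1)!)^{1/(n+1)} ≥ (n+1)/e`
  -- improves `1/(n+1)` to `e/(n+1)²`, which is summable in `n`.
  have hamgm := Real.geom_mean_le_arith_mean_weighted (Finset.range (n + 1))
    (fun _ => 1 / ((n : ℝ) + 1)) (fun j => ((j : ℝ) + 1) * a j) (fun _ _ => by positivity)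
    (by simp; field_simp) (fun j _ => mul_nonneg (by positivity) (ha j))
  rw [Real.finsetProd_rpow _ _ (fun j _ => mul_nonneg (by positivity) (ha j)),
    Finset.prod_mul_distrib, Real.mul_rpow (Finset.prod_nonneg fun j _ => by positivity)
      (Finset.prod_nonneg fun j _ => ha j), ← Finset.mul_sum] at hamgm
  have hfact : (∏ j ∈ Finset.range (n + 1), ((j : ℝ) + 1)) = ((n + 1).factorial : ℝ) := by
    rw [← Finset.prod_range_add_one_eq_factorial]; push_cast; rfl
  have hlow : ((n : ℝ) + 1) / Real.exp 1 ≤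
      (∏ j ∈ Finset.range (n + 1), ((j : ℝ) + 1)) ^ (1 / ((n : ℝ) + 1)) := by
    have hpow : (((n : ℝ) + 1) / Real.exp 1) ^ (n + 1) ≤ ((n + 1).factorial : ℝ) := by
      have h := Real.pow_div_factorial_le_exp _ hn.le (n + 1)
      have hexp : Real.exp ((n : ℝ) + 1) = Real.exp 1 ^ (n + 1) := by
        rw [← Real.exp_nat_mul]; simp
      rw [div_le_iff₀ (by positivity), hexp] at h
      rw [div_pow, div_le_iff₀ (by positivity)]
      linarith
    calc ((n : ℝ) + 1) / Real.exp 1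
        = ((((n : ℝ) + 1) / Real.exp 1) ^ (n + 1)) ^ (1 / ((n : ℝ) + 1)) := by
          rw [← Real.rpow_natCast, ← Real.rpow_mul (by positivity)]
          push_cast
          rw [mul_one_div_cancel hn.ne', Real.rpow_one]
      _ ≤ _ := by
          rw [hfact]
          exact Real.rpow_le_rpow (by positivity) hpow (by positivity)
  set G := (∏ j ∈ Finset.range (n + 1), a j) ^ (1 / ((n : ℝ) + 1))
  have hG : 0 ≤ G := Real.rpow_nonneg (Finset.prod_nonneg fun j _ => ha j) _
  have h := (mul_le_mul_of_nonneg_right hlow hG).trans hamgm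
  calc G = Real.exp 1 / ((n : ℝ) + 1) * (((n : ℝ) + 1) / Real.exp 1 * G) := by field_simp
    _ ≤ Real.exp 1 / ((n : ℝ) + 1) * (1 / ((n : ℝ) + 1) *
        ∑ j ∈ Finset.range (n + 1), ((j : ℝ) + 1) * a j) := by gcongr
    _ = _ := by field_simp

/-- Carleman's inequality with constant `2e`. Since `1/(n+1)² ≤ 2(1/(n+1) - 1/(n+2))`, summation by
parts turns the weighted sums `S` back into `∑ a_j`. -/
theorem summable_geometric_mean {a : ℕ → ℝ} (ha : ∀ j, 0 ≤ a j) (hs : Summable a) :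
    Summable fun n : ℕ => (∏ j ∈ Finset.range (n + 1), a j) ^ (1 / ((n : ℝ) + 1)) := by
  set S : ℕ → ℝ := fun n => ∑ j ∈ Finset.range n, ((j : ℝ) + 1) * a j with hS
  have hS0 : ∀ n, 0 ≤ S n := fun n =>
    Finset.sum_nonneg fun j _ => mul_nonneg (by positivity) (ha j)
  have hparts : ∀ N : ℕ, ∑ n ∈ Finset.range N, 2 * S (n + 1) * (1 / ((n : ℝ) + 1) - 1 / ((n : ℝ) + 2))
      + 2 * S N / ((N : ℝ) + 1) = 2 * ∑ j ∈ Finset.range N, a j := by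
    intro N
    induction N with
    | zero => simp [hS]
    | succ N ih =>
      rw [Finset.sum_range_succ, Finset.sum_range_succ, mul_add, ← ih]
      have : S (N + 1) = S N + ((N : ℝ) + 1) * a N := by simp [hS, Finset.sum_range_succ]
      rw [this]
      push_cast
      field_simp
      ring
  refine summable_of_sum_range_le (c := Real.exp 1 * (2 * ∑' j, a j))
    (fun n => Real.rpow_nonneg (Finset.prod_nonneg fun j _ => ha j) _) fun N => ?_
  calc ∑ n ∈ Finset.range N, (∏ j ∈ Finset.range (n + 1), a j) ^ (1 / ((n : ℝ) + 1))
      ≤ ∑ n ∈ Finset.range N,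
          Real.exp 1 * (2 * S (n + 1) * (1 / ((n : ℝ) + 1) - 1 / ((n : ℝ) + 2))) := by
        refine Finset.sum_le_sum fun n _ => (geometric_mean_le ha n).trans ?_
        have h1 : 1 / ((n : ℝ) + 1) ^ 2 ≤ 2 * (1 / ((n : ℝ) + 1) - 1 / ((n : ℝ) + 2)) := by
          have : 2 * (1 / ((n : ℝ) + 1) - 1 / ((n : ℝ) + 2)) - 1 / ((n : ℝ) + 1) ^ 2
              = (n : ℝ) / (((n : ℝ) + 1) ^ 2 * ((n : ℝ) + 2)) := by field_simp; ring
          have h2 : 0 ≤ (n : ℝ) / (((n : ℝ) + 1) ^ 2 * ((n : ℝ) + 2)) := by positivity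
          linarith
        calc _ = Real.exp 1 * (S (n + 1) * (1 / ((n : ℝ) + 1) ^ 2)) := by simp only [hS]; ring
          _ ≤ Real.exp 1 * (S (n + 1) * (2 * (1 / ((n : ℝ) + 1) - 1 / ((n : ℝ) + 2)))) := by
            have := hS0 (n + 1)
            gcongr
          _ = _ := by ring
    _ = Real.exp 1 * (2 * ∑ j ∈ Finset.range N, a j - 2 * S N / ((N : ℝ) + 1)) := by
        rw [← Finset.mul_sum, ← hparts N]; ring
    _ ≤ Real.exp 1 * (2 * ∑' j, a j) := by
        have h1 := hs.sum_le_tsum (Finset.range N) fun j _ => ha j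
        have h2 : 0 ≤ 2 * S N / ((N : ℝ) + 1) := by have := hS0 N; positivity
        gcongr
        linarith

/-! ### Taylor bounds and Bang's propagation estimate -/

theorem abs_le_taylor {f : ℝ → ℝ} (hf : ContDiff ℝ ∞ f) (n : ℕ) {C : ℝ}
    (hC : ∀ y, |iteratedDeriv n f y| ≤ C) (x y : ℝ) :
    |f y| ≤ ∑ i ∈ Finset.range n, |iteratedDeriv i f x| * |y - x| ^ i / i.factorial
      + C * |y - x| ^ n / n.factorial := by
  rcases n with - | n
  · simpa using hC y
  have hC0 : 0 ≤ C := (abs_nonneg _).trans (hC 0)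
  rcases eq_or_ne x y with rfl | hxy
  · rw [Finset.sum_range_succ']
    simp
  obtain ⟨z, -, hz⟩ := taylor_mean_remainder_lagrange_iteratedDeriv (n := n) hxy
    ((hf.of_le (by exact_mod_cast le_top)).contDiffOn)
  have hval : taylorWithinEval f n (Set.uIcc x y) x y =
      ∑ i ∈ Finset.range (n + 1), iteratedDeriv i f x * (y - x) ^ i / i.factorial := by
    rw [taylor_within_apply]
    refine Finset.sum_congr rfl fun i _ => ?_
    rw [iteratedDerivWithin_eq_iteratedDeriv (uniqueDiffOn_uIcc hxy)
      (hf.of_le (by exact_mod_cast le_top)).contDiffAt Set.left_mem_uIcc, smul_eq_mul]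
    field_simp
  have hfy : f y = ∑ i ∈ Finset.range (n + 1), iteratedDeriv i f x * (y - x) ^ i / i.factorial
      + iteratedDeriv (n + 1) f z * (y - x) ^ (n + 1) / (n + 1).factorial := by
    rw [← hval, ← hz]; ring
  rw [hfy]
  refine (abs_add_le _ _).trans (add_le_add ((Finset.abs_sum_le_sum_abs _ _).trans_eq ?_) ?_)
  · refine Finset.sum_congr rfl fun i _ => ?_
    rw [abs_div, abs_mul, abs_pow, Nat.abs_cast]
  · rw [abs_div, abs_mul, abs_pow, Nat.abs_cast]
    gcongr
    exact hC z

theorem contDiff_iteratedDeriv {f : ℝ → ℝ} (hf : ContDiff ℝ ∞ f) (n : ℕ) :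
    ContDiff ℝ ∞ (iteratedDeriv n f) := by
  rw [iteratedDeriv_eq_iterate]
  exact hf.iterate_deriv n

/-- Bang's estimate: bounds relative to `e^i p_i` on the derivatives of order `< N` propagate. -/
theorem bang_step {f : ℝ → ℝ} (hf : ContDiff ℝ ∞ f) {N : ℕ} {p : ℕ → ℝ} {μ c : ℝ} (hμ : 0 ≤ μ)
    (hp : ∀ j, 0 < p j) (hgrow : ∀ j l, j + l ≤ N → p (j + l) ≤ p j * μ ^ l)
    (hN : ∀ y, |iteratedDeriv N f y| ≤ p N) (hc : Real.exp (-N) ≤ c) {x y : ℝ}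
    (hx : ∀ i < N, |iteratedDeriv i f x| ≤ c * Real.exp i * p i) (i : ℕ) (hi : i < N) :
    |iteratedDeriv i f y| ≤ c * Real.exp (Real.exp 1 * μ * |y - x|) * Real.exp i * p i := by
  have hc0 : 0 ≤ c := (Real.exp_pos _).le.trans hc
  obtain ⟨n, rfl⟩ := Nat.exists_eq_add_of_lt hi
  have hiter : ∀ l, iteratedDeriv l (iteratedDeriv i f) = iteratedDeriv (i + l) f := by
    intro l
    simp only [iteratedDeriv_eq_iterate]
    rw [← Function.iterate_add_apply, add_comm]
  have hle : ∀ l, i + l ≤ i + n + 1 → c * Real.exp ((i + l : ℕ) : ℝ) * p (i + l) ≤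
      c * Real.exp i * p i * (Real.exp 1 * μ) ^ l := by
    intro l hl
    calc _ ≤ c * Real.exp ((i + l : ℕ) : ℝ) * (p i * μ ^ l) := by gcongr; exact hgrow i l hl
      _ = _ := by
        rw [Nat.cast_add, Real.exp_add, mul_pow, ← Real.exp_nat_mul]
        ring_nf
  -- The Taylor terms are those of the series of `exp (e μ |y - x|)`; the remainder fits as one more
  -- term of the same series.
  have ht := abs_le_taylor (contDiff_iteratedDeriv hf i) (n + 1)
    (C := c * Real.exp i * p i * (Real.exp 1 * μ) ^ (n + 1)) (fun z => ?_) x y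
  · refine ht.trans ?_
    calc _ ≤ ∑ l ∈ Finset.range (n + 1), c * Real.exp i * p i * (Real.exp 1 * μ) ^ l * |y - x| ^ l
          / l.factorial + c * Real.exp i * p i * (Real.exp 1 * μ) ^ (n + 1) * |y - x| ^ (n + 1)
          / (n + 1).factorial := by
          gcongr with l hl
          rw [hiter]
          have hl := Finset.mem_range.1 hl
          exact (hx _ (by omega)).trans (hle l (by omega))
      _ = c * Real.exp i * p i * ∑ l ∈ Finset.range (n + 2), (Real.exp 1 * μ * |y - x|) ^ l
          / l.factorial := by
          rw [← Finset.sum_range_succ (fun l => c * Real.exp i * p i * (Real.exp 1 * μ) ^ l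
            * |y - x| ^ l / (l.factorial : ℝ)), Finset.mul_sum]
          refine Finset.sum_congr rfl fun l _ => ?_
          rw [mul_pow _ |y - x|]; ring
      _ ≤ c * Real.exp i * p i * Real.exp (Real.exp 1 * μ * |y - x|) := by
          have := hp i
          gcongr
          exact Real.sum_le_exp_of_nonneg (by positivity) _
      _ = _ := by ring
  · rw [hiter]
    refine (hN z).trans (le_trans ?_ (hle (n + 1) le_rfl))
    -- The condition `c ≥ e^{-N}` makes the global bound `p N` at the top order at least as strong
    -- as the form `c e^N p N` of the local bounds.
    have h1 : 1 ≤ c * Real.exp ((i + (n + 1) : ℕ) : ℝ) := by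
      calc (1 : ℝ) = Real.exp (-((i + n + 1 : ℕ) : ℝ)) * Real.exp ((i + (n + 1) : ℕ) : ℝ) := by
            rw [← Real.exp_add]; simp [add_assoc]
        _ ≤ _ := by gcongr
    exact le_mul_of_one_le_left (hp _).le h1

/-! ### The Newton polygon of a superlinear sequence -/

section NewtonPolygon

/-- The slope of the chord of the graph of `u` between `a` and `b`. -/
noncomputable def chord (u : ℕ → ℝ) (a b : ℕ) : ℝ := (u b - u a) / ((b : ℝ) - a)

/-- Superlinear growth keeps the chord slopes from `a` to all distant points above the slope `s` to
`a + 1`, so the minimum is over a finite range. -/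
theorem exists_min_chord {u : ℕ → ℝ} (hu : ∀ C : ℝ, ∀ᶠ n in Filter.atTop, C * n ≤ u n) (a : ℕ) :
    ∃ b > a, ∀ n > a, chord u a b ≤ chord u a n := by
  set s := chord u a (a + 1) with hs
  obtain ⟨N, hN⟩ := Filter.eventually_atTop.1
    ((hu (|s| + |u a|)).and (Filter.eventually_gt_atTop a))
  have hfar : ∀ n ≥ N, s ≤ chord u a n := by
    intro n hn
    obtain ⟨h1, h2⟩ := hN n hn
    have h3 : (0 : ℝ) < (n : ℝ) - a := sub_pos.2 (by exact_mod_cast h2)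
    have h4 : (1 : ℝ) ≤ n := by exact_mod_cast (by omega : 1 ≤ n)
    rw [chord, le_div_iff₀ h3]
    have h5 : s * ((n : ℝ) - a) ≤ |s| * n := by
      have := le_abs_self s
      have h6 : (0 : ℝ) ≤ a := Nat.cast_nonneg a
      nlinarith [abs_nonneg s]
    have h7 := le_abs_self (u a)
    nlinarith [abs_nonneg (u a)]
  obtain ⟨b, hb, hmin⟩ := Finset.exists_min_image (Finset.Ioc a (a + 1 + N)) (chord u a)
    ⟨a + 1, by simp⟩
  refine ⟨b, (Finset.mem_Ioc.1 hb).1, fun n hn => ?_⟩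
  by_cases h : n ≤ a + 1 + N
  · exact hmin n (Finset.mem_Ioc.2 ⟨hn, h⟩)
  · exact (hmin (a + 1) (by simp)).trans (hfar n (by omega))

/-- The last vertex `≤ j` of the Newton polygon whose vertices are `0`, `nxt 0`, `nxt (nxt 0)`, …. -/
def lastVertex (nxt : ℕ → ℕ) : ℕ → ℕ
  | 0 => 0
  | j + 1 => if nxt (lastVertex nxt j) = j + 1 then j + 1 else lastVertex nxt j

variable {u : ℕ → ℝ} {nxt : ℕ → ℕ}

theorem lastVertex_bounds (h : ∀ a, a < nxt a) (j : ℕ) :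
    lastVertex nxt j ≤ j ∧ j < nxt (lastVertex nxt j) := by
  induction j with
  | zero => exact ⟨le_rfl, h 0⟩
  | succ j ih =>
    rw [lastVertex]
    split_ifs with hj
    · exact ⟨le_rfl, h _⟩
    · omega

theorem lastVertex_eq_of_lt {j l : ℕ} (hjl : j ≤ l)
    (hl : l < nxt (lastVertex nxt j)) : lastVertex nxt l = lastVertex nxt j := by
  induction l, hjl using Nat.le_induction with
  | base => rfl
  | succ l hjl ih =>
    have := ih (by omega)
    rw [lastVertex, this, if_neg (by omega)]

theorem lastVertex_nxt (h : ∀ a, a < nxt a) (j : ℕ) :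
    lastVertex nxt (nxt (lastVertex nxt j)) = nxt (lastVertex nxt j) := by
  obtain ⟨h1, h2⟩ := lastVertex_bounds h j
  obtain ⟨l, hl⟩ : ∃ l, nxt (lastVertex nxt j) = l + 1 :=
    ⟨nxt (lastVertex nxt j) - 1, by omega⟩
  have h3 : lastVertex nxt l = lastVertex nxt j := lastVertex_eq_of_lt (by omega) (by omega)
  rw [hl, lastVertex, h3, if_pos hl]

/-- The slope of the Newton polygon between `j` and `j + 1`. -/
noncomputable def polygonSlope (u : ℕ → ℝ) (nxt : ℕ → ℕ) (j : ℕ) : ℝ :=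
  chord u (lastVertex nxt j) (nxt (lastVertex nxt j))

/-- The Newton polygon of `u`, a convex minorant of `u`. -/
noncomputable def polygon (u : ℕ → ℝ) (nxt : ℕ → ℕ) (j : ℕ) : ℝ :=
  u (lastVertex nxt j) + polygonSlope u nxt j * ((j : ℝ) - lastVertex nxt j)

theorem polygon_of_lastVertex_eq {j : ℕ} (hj : lastVertex nxt j = j) :
    polygon u nxt j = u j := by
  simp [polygon, hj]

theorem polygon_succ (h : ∀ a, a < nxt a) (j : ℕ) :
    polygon u nxt (j + 1) = polygon u nxt j + polygonSlope u nxt j := by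
  by_cases hj : nxt (lastVertex nxt j) = j + 1
  · rw [polygon_of_lastVertex_eq (by rw [lastVertex, if_pos hj]), polygon, polygonSlope, chord, hj]
    have h1 : (lastVertex nxt j : ℝ) < ((j + 1 : ℕ) : ℝ) := by
      exact_mod_cast Nat.lt_succ_of_le (lastVertex_bounds h j).1
    have h2 : ((j + 1 : ℕ) : ℝ) - lastVertex nxt j ≠ 0 := (sub_pos.2 h1).ne'
    push_cast at h2 ⊢
    field_simp
    ring
  · have h1 : lastVertex nxt (j + 1) = lastVertex nxt j := by rw [lastVertex, if_neg hj]
    simp only [polygon, polygonSlope, h1]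
    push_cast
    ring

theorem polygon_le (h : ∀ a, a < nxt a) (hmin : ∀ a, ∀ n > a, chord u a (nxt a) ≤ chord u a n)
    (j : ℕ) : polygon u nxt j ≤ u j := by
  rcases (lastVertex_bounds h j).1.eq_or_lt with hj | hj
  · exact (polygon_of_lastVertex_eq hj).le
  · have h1 : (0 : ℝ) < (j : ℝ) - lastVertex nxt j := sub_pos.2 (by exact_mod_cast hj)
    have h2 := hmin _ j hj
    rw [chord, chord, le_div_iff₀ h1] at h2
    rw [polygon, polygonSlope, chord]
    linarith

/-- Slopes change only at a vertex. If the edge leaving a vertex were less steep than the edge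
entering it, the chord skipping that vertex would undercut the minimal slope. -/
theorem polygonSlope_mono (h : ∀ a, a < nxt a)
    (hmin : ∀ a, ∀ n > a, chord u a (nxt a) ≤ chord u a n) : Monotone (polygonSlope u nxt) := by
  refine monotone_nat_of_le_succ fun j => ?_
  by_cases hj : nxt (lastVertex nxt j) = j + 1
  · have hv : lastVertex nxt (j + 1) = j + 1 := by rw [lastVertex, if_pos hj]
    set b := nxt (j + 1) with hb
    have hjb : j + 1 < b := h (j + 1)
    have hle := (lastVertex_bounds h j).1
    have h1 : (0 : ℝ) < ((j + 1 : ℕ) : ℝ) - lastVertex nxt j :=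
      sub_pos.2 (by exact_mod_cast Nat.lt_succ_of_le hle)
    have h2 : (0 : ℝ) < (b : ℝ) - ((j + 1 : ℕ) : ℝ) := sub_pos.2 (by exact_mod_cast hjb)
    have h3 := hmin (lastVertex nxt j) b (by omega)
    rw [polygonSlope, polygonSlope, hv, ← hb]
    set s := chord u (lastVertex nxt j) (nxt (lastVertex nxt j)) with hs
    have h4 : s * (((j + 1 : ℕ) : ℝ) - lastVertex nxt j) = u (j + 1) - u (lastVertex nxt j) := by
      rw [hs, hj, chord, div_mul_cancel₀ _ h1.ne']
    rw [chord, le_div_iff₀ (by linarith)] at h3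
    rw [chord, le_div_iff₀ h2]
    linarith
  · have h1 : lastVertex nxt (j + 1) = lastVertex nxt j := by rw [lastVertex, if_neg hj]
    simp only [polygonSlope, h1, le_refl]

/-- Up to the next vertex, even indices beyond `j` lie on the edge of `j`. This yields the geometric
growth bound needed in Bang's estimate. -/
theorem polygonSlope_le_of_lt (h : ∀ a, a < nxt a)
    (hmin : ∀ a, ∀ n > a, chord u a (nxt a) ≤ chord u a n) {j l : ℕ}
    (hl : l < nxt (lastVertex nxt j)) : polygonSlope u nxt l ≤ polygonSlope u nxt j := by
  rcases le_total l j with hlj | hlj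
  · exact polygonSlope_mono h hmin hlj
  · rw [polygonSlope, polygonSlope, lastVertex_eq_of_lt hlj hl]

theorem nxt_lastVertex_mono (h : ∀ a, a < nxt a) (j : ℕ) :
    nxt (lastVertex nxt j) ≤ nxt (lastVertex nxt (j + 1)) := by
  rw [lastVertex]
  split_ifs with hj
  · rw [hj]; exact (h _).le
  · exact le_rfl

end NewtonPolygon

/-! ### The Denjoy–Carleman theorem -/

/-- If the derivatives at `0` vanish and are not too large on a subsequence, `f` vanishes. -/
theorem eq_zero_of_frequently_le {f : ℝ → ℝ} (hf : ContDiff ℝ ∞ f)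
    (h0 : ∀ n, iteratedDeriv n f 0 = 0) {M : ℕ → ℝ}
    (hb : ∀ n x, |iteratedDeriv n f x| ≤ M n) {C : ℝ}
    (hM : ∃ᶠ n in Filter.atTop, M n ≤ C ^ n) (x : ℝ) : f x = 0 := by
  have hlim := FloorSemiring.tendsto_pow_div_factorial_atTop (C * |x|)
  by_contra hx
  have hev := hlim.eventually_lt_const (abs_pos.2 hx)
  obtain ⟨n, hn1, hn2⟩ := (hM.and_eventually hev).exists
  have h1 := abs_le_taylor hf n (hb n) 0 x
  simp only [h0, abs_zero, zero_mul, zero_div, Finset.sum_const_zero, zero_add, sub_zero] at h1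
  have h2 : M n * |x| ^ n / n.factorial ≤ (C * |x|) ^ n / n.factorial := by
    rw [mul_pow]; gcongr
  linarith

/-- The Denjoy–Carleman theorem: a smooth function that is flat at `0` vanishes if the bounds
`M n` of its derivatives satisfy `∑ (M n)^(-1/n) = ∞`. -/
theorem denjoy_carleman {f : ℝ → ℝ} (hf : ContDiff ℝ ∞ f)
    (h0 : ∀ n, iteratedDeriv n f 0 = 0) {M : ℕ → ℝ} (hM : ∀ n, 0 < M n)
    (hb : ∀ n x, |iteratedDeriv n f x| ≤ M n)
    (hdiv : ¬ Summable fun n : ℕ => (M (n + 1) ^ (1 / ((n : ℝ) + 1)))⁻¹) (x : ℝ) : f x = 0 := by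
  by_cases hu : ∀ C : ℝ, ∀ᶠ n : ℕ in Filter.atTop, C * n ≤ Real.log (M n)
  swap
  -- If `log M n` is not superlinear, `M n ≤ e^{Cn}` infinitely often and the Taylor remainder at
  -- `0` tends to zero along those `n`.
  · push Not at hu
    obtain ⟨C, hC⟩ := hu
    refine eq_zero_of_frequently_le hf h0 hb (C := Real.exp C) (hC.mono fun n hn => ?_) x
    rw [← Real.exp_nat_mul, mul_comm, ← Real.exp_log (hM n)]
    exact Real.exp_le_exp.2 hn.le
  set u : ℕ → ℝ := fun n => Real.log (M n) with hu_def
  choose nxt hnxt hmin using exists_min_chord (u := u) hu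
  set σ := polygonSlope u nxt
  set P := polygon u nxt
  have hPs : ∀ j, P (j + 1) = P j + σ j := polygon_succ hnxt
  have hPle : ∀ j, P j ≤ u j := polygon_le hnxt hmin
  have hPsum : ∀ n, P n = P 0 + ∑ j ∈ Finset.range n, σ j := by
    intro n
    induction n with
    | zero => simp
    | succ n ih => rw [Finset.sum_range_succ, hPs, ih, add_assoc]
  -- `M_{n+1}^{-1/(n+1)} ≤ exp (-P (n+1) / (n+1))`, which up to a bounded factor is the geometric
  -- mean of `e^{-σ 0}, …, e^{-σ n}`; Carleman's inequality applies.
  have hsigma : ¬ Summable fun j => Real.exp (-σ j) := by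
    intro hs
    refine hdiv (Summable.of_nonneg_of_le (fun n => ?_) (fun n => ?_)
      ((summable_geometric_mean (fun j => (Real.exp_pos _).le) hs).mul_left
        (max 1 (Real.exp (-P 0)))))
    · have := (hM (n + 1)).le; positivity
    · rw [← Real.exp_sum, ← Real.exp_mul, ← Real.exp_log (hM (n + 1)), ← Real.exp_mul,
        ← Real.exp_neg]
      have hn : (0 : ℝ) < 1 / ((n : ℝ) + 1) := by positivity
      have hn1 : 1 / ((n : ℝ) + 1) ≤ 1 := by
        rw [div_le_one (by positivity)]; linarith [(Nat.cast_nonneg n : (0 : ℝ) ≤ n)]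
      calc _ ≤ Real.exp (-P 0 * (1 / ((n : ℝ) + 1)) +
            (∑ j ∈ Finset.range (n + 1), -σ j) * (1 / ((n : ℝ) + 1))) := by
            apply Real.exp_le_exp.2
            have h1 := (hPsum (n + 1)) ▸ hPle (n + 1)
            have h2 := mul_le_mul_of_nonneg_right h1 hn.le
            simp only [Finset.sum_neg_distrib]
            simp only [hu_def] at h2
            linarith
        _ ≤ _ := by
            rw [Real.exp_add]
            gcongr
            rcases le_total (P 0) 0 with h | h
            · refine le_trans (Real.exp_le_exp.2 ?_) (le_max_right _ _)
              nlinarith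
            · refine le_trans (Real.exp_le_one_iff.2 ?_) (le_max_left _ _)
              nlinarith
  -- `N j` is the first vertex beyond `j`. There the polygon meets `log M`, so `e^P` is a genuine
  -- bound for the derivative of order `N j`.
  set N : ℕ → ℕ := fun j => nxt (lastVertex nxt j)
  have hN : ∀ j, j < N j := fun j => (lastVertex_bounds hnxt j).2
  have hPN : ∀ j, P (N j) = Real.log (M (N j)) := fun j =>
    polygon_of_lastVertex_eq (lastVertex_nxt hnxt j)
  -- Moving by at most `e^{-σ j - 1}` costs a factor `e`, that is, one unit of `j`. Bang's estimate
  -- applies with `μ = e^{σ j}` and `c = e^{-(j+1)}`, and `c ≥ e^{-N j}` because `j + 1 ≤ N j`.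
  have hstep : ∀ j y z, |z - y| ≤ Real.exp (-σ j) / Real.exp 1 →
      (∀ i < N j, |iteratedDeriv i f y| ≤ Real.exp (-((j + 1 : ℕ) : ℝ)) * Real.exp i * Real.exp (P i)) →
      ∀ i < N j, |iteratedDeriv i f z| ≤ Real.exp (-(j : ℝ)) * Real.exp i * Real.exp (P i) := by
    intro j y z hyz hy i hi
    have hNj : N j = nxt (lastVertex nxt j) := rfl
    have hgrow : ∀ l k, l + k ≤ N j → Real.exp (P (l + k)) ≤ Real.exp (P l) * Real.exp (σ j) ^ k := by
      intro l k
      induction k with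
      | zero => simp
      | succ k ih =>
        intro hlk
        have h1 : σ (l + k) ≤ σ j := polygonSlope_le_of_lt hnxt hmin (by omega)
        rw [← add_assoc, hPs, Real.exp_add, pow_succ, ← mul_assoc]
        gcongr
        exact ih (by omega)
    refine (bang_step hf (p := fun i => Real.exp (P i)) (Real.exp_pos (σ j)).le
      (fun _ => Real.exp_pos _) hgrow (fun y => ?_) (Real.exp_le_exp.2 ?_) hy i hi).trans ?_
    · rw [hPN, Real.exp_log (hM _)]; exact hb _ y
    · have : j + 1 ≤ N j := hN j
      rw [neg_le_neg_iff]; exact_mod_cast this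
    · have h1 : Real.exp 1 * Real.exp (σ j) * |z - y| ≤ 1 := by
        calc _ ≤ Real.exp 1 * Real.exp (σ j) * (Real.exp (-σ j) / Real.exp 1) := by gcongr
          _ = 1 := by rw [Real.exp_neg]; field_simp
      gcongr
      rw [← Real.exp_add]
      apply Real.exp_le_exp.2
      push_cast
      linarith
  -- Flatness at `0` gives the bounds at level `j + k` for free; `k` moves away from `0` bring the
  -- level down to `j`.
  have hchain : ∀ k j y, |y| ≤ ∑ i ∈ Finset.range k, Real.exp (-σ (j + i)) / Real.exp 1 →
      ∀ i < N j, |iteratedDeriv i f y| ≤ Real.exp (-(j : ℝ)) * Real.exp i * Real.exp (P i) := by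
    intro k
    induction k with
    | zero =>
      intro j y hy i _
      have : y = 0 := by simpa using hy
      rw [this, h0, abs_zero]
      positivity
    | succ k ih =>
      intro j y hy
      rw [Finset.sum_range_succ'] at hy
      simp only [add_zero] at hy
      set T := ∑ i ∈ Finset.range k, Real.exp (-σ (j + (i + 1))) / Real.exp 1 with hT
      have hT0 : 0 ≤ T := Finset.sum_nonneg fun _ _ => by positivity
      -- The truncation of `y` to `[-T, T]` is within one admissible step of `y`.
      set y' := max (-T) (min y T) with hy'
      have h1 : |y'| ≤ T := by
        rw [abs_le]; exact ⟨le_max_left _ _, max_le (by linarith) (min_le_right _ _)⟩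
      have h2 : |y - y'| ≤ Real.exp (-σ j) / Real.exp 1 := by
        have hpos : 0 ≤ Real.exp (-σ j) / Real.exp 1 := by positivity
        rw [abs_le] at hy ⊢
        rcases max_cases (-T) (min y T) with ⟨e1, e2⟩ | ⟨e1, e2⟩ <;>
        rcases min_cases y T with ⟨e3, e4⟩ | ⟨e3, e4⟩ <;>
        constructor <;> linarith
      refine hstep j y' y h2 fun i hi => ?_
      exact ih (j + 1) y' (h1.trans_eq (Finset.sum_congr rfl fun i _ => by
        rw [show j + (i + 1) = j + 1 + i by omega])) i
        (lt_of_lt_of_le hi (nxt_lastVertex_mono hnxt j))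
  -- By divergence, `k` steps starting from level `j + k` reach `x` for every `j`; letting `j → ∞`
  -- then forces `f x = 0`.
  have hsmall : ∀ j : ℕ, |f x| ≤ Real.exp (-(j : ℝ)) * Real.exp (P 0) := by
    intro j
    have hs : ¬ Summable fun i => Real.exp (-σ (i + j)) / Real.exp 1 := by
      intro h
      refine hsigma ((summable_nat_add_iff j).1 ((h.mul_right (Real.exp 1)).congr fun i => ?_))
      field_simp
    have ht := (not_summable_iff_tendsto_nat_atTop_of_nonneg (fun i => by positivity)).1 hs
    obtain ⟨k, hk⟩ := (ht.eventually_ge_atTop |x|).exists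
    have := hchain k j x (hk.trans_eq (Finset.sum_congr rfl fun i _ => by rw [add_comm])) 0
      (lt_of_le_of_lt (Nat.zero_le j) (hN j))
    simpa using this
  have hlim : Filter.Tendsto (fun j : ℕ => Real.exp (-(j : ℝ)) * Real.exp (P 0)) Filter.atTop
      (nhds 0) := by
    have := (Real.tendsto_exp_neg_atTop_nhds_zero.comp
      (tendsto_natCast_atTop_atTop (R := ℝ))).mul_const (Real.exp (P 0))
    simpa using this
  exact abs_nonpos_iff.1 (ge_of_tendsto' hlim hsmall)

/-- A nonnegative sequence with `∑ 1 / (M n)^(1/n) = ∞` in `[0, ∞]` has a quasi-analytic class. -/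
theorem isQuasiAnalytic_of_tsum_eq_top {M : ℕ → ℝ} (hM : ∀ n, 0 ≤ M n)
    (hdiv : ∑' n : ℕ, (ENNReal.ofReal (M (n + 1) ^ (1 / ((n : ℝ) + 1))))⁻¹ = ⊤) :
    IsQuasiAnalytic M := by
  rintro f ⟨hf, β, hβ, B, hB, hbound⟩ h0 x
  by_cases hpos : ∀ n, 0 < M n
  swap
  -- If some `M n` is zero, the derivative of order `n` vanishes identically, and the Taylor formula
  -- at the flat point gives `f = 0`.
  · push Not at hpos
    obtain ⟨n, hn⟩ := hpos
    have h1 := abs_le_taylor hf n (hbound n) 0 x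
    have h2 : M n = 0 := le_antisymm hn (hM n)
    simp only [h0, h2] at h1
    simpa using h1
  refine denjoy_carleman hf h0 (M := fun n => β * B ^ n * M n)
    (fun n => mul_pos (by positivity) (hpos n)) hbound (fun hs => ?_) x
  have hsum : Summable fun n : ℕ => (M (n + 1) ^ (1 / ((n : ℝ) + 1)))⁻¹ := by
    refine Summable.of_nonneg_of_le (fun n => ?_) (fun n => ?_) (hs.mul_left (max 1 β * B))
    · have := hM (n + 1); positivity
    · have hn : (0 : ℝ) < (n : ℝ) + 1 := by positivity
      have hn1 : 1 / ((n : ℝ) + 1) ≤ 1 := by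
        rw [div_le_one hn]; linarith [(Nat.cast_nonneg n : (0 : ℝ) ≤ n)]
      have hβ1 : β ^ (1 / ((n : ℝ) + 1)) ≤ max 1 β := by
        rcases le_total 1 β with h | h
        · exact ((Real.rpow_le_rpow_of_exponent_le h hn1).trans_eq (Real.rpow_one β)).trans
            (le_max_right _ _)
        · exact (Real.rpow_le_one hβ.le h (by positivity)).trans (le_max_left _ _)
      have hBp : (B ^ (n + 1)) ^ (1 / ((n : ℝ) + 1)) = B := by
        rw [← Real.rpow_natCast, ← Real.rpow_mul hB.le]
        push_cast
        rw [mul_one_div_cancel hn.ne', Real.rpow_one]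
      have hMp := Real.rpow_pos_of_pos (hpos (n + 1)) (1 / ((n : ℝ) + 1))
      have hβp := Real.rpow_pos_of_pos hβ (1 / ((n : ℝ) + 1))
      rw [Real.mul_rpow (by positivity) (hM _), Real.mul_rpow hβ.le (by positivity), hBp,
        inv_eq_one_div, ← div_eq_mul_inv, div_le_div_iff₀ hMp (by positivity), one_mul]
      gcongr
  refine hsum.tsum_ofReal_ne_top ?_
  rw [← hdiv]
  exact tsum_congr fun n =>
    ENNReal.ofReal_inv_of_pos (Real.rpow_pos_of_pos (hpos (n + 1)) _)

/-! ### Radon measures are continuous on the test function space -/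

open MeasureTheory

/-- Write `g x` as an integral of `g'` over the half-line pointing away from `0`. On it `|t| ≥ |x|`,
so the weight `h x` may be replaced by `h t`. -/
theorem mul_enorm_le_lintegral_deriv {g : ℝ → ℝ} (hg : ContDiff ℝ 1 g) (hg' : HasCompactSupport g)
    (h : ℝ → ℝ≥0∞) (x : ℝ) (hx : ∀ t, |x| ≤ |t| → h x ≤ h t) :
    h x * ‖g x‖ₑ ≤ ∫⁻ t, h t * ‖deriv g t‖ₑ := by
  have left : ∀ (g : ℝ → ℝ) (h : ℝ → ℝ≥0∞) (x : ℝ), ContDiff ℝ 1 g → HasCompactSupport g →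
      (∀ t ≤ x, h x ≤ h t) → h x * ‖g x‖ₑ ≤ ∫⁻ t, h t * ‖deriv g t‖ₑ := by
    intro g h x hg hg' hx
    have hmeas : Measurable fun t => ‖deriv g t‖ₑ :=
      (hg.continuous_deriv le_rfl).measurable.enorm
    calc h x * ‖g x‖ₑ ≤ h x * ∫⁻ t in Set.Iic x, ‖deriv g t‖ₑ := by
          gcongr
          exact hg'.enorm_le_lintegral_Ici_deriv hg x
      _ = ∫⁻ t in Set.Iic x, h x * ‖deriv g t‖ₑ := (lintegral_const_mul _ hmeas).symm
      _ ≤ ∫⁻ t in Set.Iic x, h t * ‖deriv g t‖ₑ := by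
          refine setLIntegral_mono' measurableSet_Iic fun t ht => ?_
          gcongr
          exact hx t ht
      _ ≤ _ := setLIntegral_le_lintegral _ _
  rcases le_total x 0 with h0 | h0
  · exact left g h x hg hg' fun t ht => hx t (by
      rw [abs_of_nonpos h0, abs_of_nonpos (ht.trans h0)]; linarith)
  · have := left (fun t => g (-t)) (fun t => h (-t)) (-x) (hg.comp contDiff_neg)
      (hg'.comp_homeomorph (Homeomorph.neg ℝ)) fun t ht => by
        rw [neg_neg]
        exact hx _ (by rw [abs_of_nonneg h0, abs_of_nonneg (by linarith)]; linarith)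
    simp only [neg_neg, deriv_comp_neg, enorm_neg] at this
    rwa [lintegral_neg_eq_self (fun t => h t * ‖deriv g t‖ₑ)] at this

/-! ### Weights adapted to a Radon measure -/

section
variable {ι : Type} [Fintype ι]

/-- A smooth partition of unity glues local constants: near `x` the value `G (‖x‖ + 1)` is large
enough, `G` being monotone. -/
theorem exists_smooth_ge {G : ℝ → ℝ} (hG : Monotone G) :
    ∃ W : EuclideanSpace ℝ ι → ℝ, ContDiff ℝ ∞ W ∧ (∀ r, 1 ≤ W r) ∧ ∀ r, G ‖r‖ ≤ W r := by
  obtain ⟨g, hg⟩ := exists_contMDiffMap_forall_mem_convex_of_local_const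
    (I := modelWithCornersSelf ℝ (EuclideanSpace ℝ ι)) (n := ⊤)
    (t := fun r : EuclideanSpace ℝ ι => Set.Ici (max 1 (G ‖r‖))) (fun r => convex_Ici _)
    (fun x => ⟨max 1 (G (‖x‖ + 1)), by
      have : ∀ᶠ y : EuclideanSpace ℝ ι in nhds x, ‖y‖ < ‖x‖ + 1 :=
        continuous_norm.continuousAt.eventually_lt_const (by simp)
      filter_upwards [this] with y hy
      exact max_le_max le_rfl (hG hy.le)⟩)
  exact ⟨g, g.contMDiff.contDiff, fun r => (le_max_left _ _).trans (hg r),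
    fun r => (le_max_right _ _).trans (hg r)⟩

/-- `G` takes the value `2^n (1 + μ(B_n))` at `n = ⌈t⌉₊`, so the shell with `⌈‖x‖⌉₊ = n` contributes
at most `2^{-n}`. -/
theorem exists_lintegral_inv_ne_top (μ : Measure (EuclideanSpace ℝ ι))
    [IsFiniteMeasureOnCompacts μ] :
    ∃ G : ℝ → ℝ, Monotone G ∧ (∀ t, 0 < G t) ∧ ∫⁻ x, (ENNReal.ofReal (G ‖x‖))⁻¹ ∂μ ≠ ⊤ := by
  set B : ℕ → Set (EuclideanSpace ℝ ι) := fun n => Metric.closedBall 0 n with hB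
  have hBfin : ∀ n, μ (B n) ≠ ⊤ := fun n => (isCompact_closedBall _ _).measure_lt_top.ne
  set g : ℕ → ℝ := fun n => 2 ^ n * (1 + (μ (B n)).toReal) with hg
  have hg0 : ∀ n, 0 < g n := fun n => by positivity
  refine ⟨fun t => g ⌈t⌉₊, fun s t hst => ?_, fun t => hg0 _, ne_top_of_le_ne_top
    (b := ∑' n : ℕ, (2⁻¹ : ℝ≥0∞) ^ n) ?_ ?_⟩
  · have h1 : ⌈s⌉₊ ≤ ⌈t⌉₊ := Nat.ceil_mono hst
    have h2 : (μ (B ⌈s⌉₊)).toReal ≤ (μ (B ⌈t⌉₊)).toReal :=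
      ENNReal.toReal_mono (hBfin _) (measure_mono (Metric.closedBall_subset_closedBall
        (by exact_mod_cast h1)))
    simp only [hg]
    gcongr
    norm_num
  · rw [ENNReal.tsum_geometric]; simp
  · calc ∫⁻ x, (ENNReal.ofReal (g ⌈‖x‖⌉₊))⁻¹ ∂μ
        ≤ ∫⁻ x, ∑' n, (B n).indicator (fun _ => (ENNReal.ofReal (g n))⁻¹) x ∂μ := by
          refine lintegral_mono fun x => le_trans (le_of_eq ?_) (ENNReal.le_tsum ⌈‖x‖⌉₊)
          rw [Set.indicator_of_mem]
          simpa [hB] using Nat.le_ceil ‖x‖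
      _ = ∑' n, (ENNReal.ofReal (g n))⁻¹ * μ (B n) := by
          have hBm : ∀ n, MeasurableSet (B n) := fun n => Metric.isClosed_closedBall.measurableSet
          rw [lintegral_tsum fun n => (measurable_const.indicator (hBm n)).aemeasurable]
          exact tsum_congr fun n => lintegral_indicator_const (hBm n) _
      _ ≤ ∑' n, (2⁻¹ : ℝ≥0∞) ^ n := by
          refine ENNReal.tsum_le_tsum fun n => ?_
          rw [← ENNReal.ofReal_inv_of_pos (hg0 n), ← ENNReal.ofReal_toReal (hBfin n),
            ← ENNReal.ofReal_mul (inv_nonneg.2 (hg0 n).le)]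
          have h2 : (2⁻¹ : ℝ≥0∞) = ENNReal.ofReal (2⁻¹) := by
            rw [ENNReal.ofReal_inv_of_pos two_pos]; simp
          rw [h2, ← ENNReal.ofReal_pow (by norm_num)]
          refine ENNReal.ofReal_le_ofReal ?_
          have h3 : (0 : ℝ) ≤ (μ (B n)).toReal := ENNReal.toReal_nonneg
          simp only [hg]
          rw [inv_mul_le_iff₀ (by positivity), inv_pow, mul_assoc, mul_comm, mul_assoc,
            inv_mul_cancel₀ (by positivity)]
          linarith

theorem TestSpace.integrable (μ : Measure (EuclideanSpace ℝ ι)) [IsFiniteMeasureOnCompacts μ]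
    (f : TestSpace ι) : Integrable f μ :=
  f.contDiff.continuous.integrable_of_hasCompactSupport f.hasCompactSupport

end

/-! ### Weighted Sobolev embedding and continuity of Radon measures -/

section
variable {ι : Type} [Fintype ι] [DecidableEq ι]

theorem contDiff_toLp_update (x : ι → ℝ) (i : ι) :
    ContDiff ℝ ∞ fun t : ℝ => (WithLp.toLp 2 (Function.update x i t) : EuclideanSpace ℝ ι) := by
  rw [contDiff_euclidean]
  intro j
  exact (contDiff_pi.1 (contDiff_update (𝕜 := ℝ) ∞ x i)) j

theorem deriv_comp_toLp_update {f : EuclideanSpace ℝ ι → ℝ} (hf : ContDiff ℝ ∞ f) (x : ι → ℝ)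
    (i : ι) (t : ℝ) : deriv (fun t : ℝ => f (WithLp.toLp 2 (Function.update x i t))) t =
      partialD i f (WithLp.toLp 2 (Function.update x i t)) := by
  have h1 : HasDerivAt (fun t : ℝ => (WithLp.toLp 2 (Function.update x i t) : EuclideanSpace ℝ ι))
      (EuclideanSpace.single i 1) t := by
    have := ((PiLp.continuousLinearEquiv 2 ℝ (fun _ : ι => ℝ)).symm.hasFDerivAt).comp_hasDerivAt t
      (hasDerivAt_update x i t)
    exact this
  exact (((hf.differentiable (by simp)) _).hasFDerivAt.comp_hasDerivAt t h1).deriv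

/-- A weight that increases with the norm can be taken inside the fundamental theorem of calculus
in one coordinate. -/
theorem mul_enorm_le_lintegral_partialD {f : EuclideanSpace ℝ ι → ℝ} (hf : ContDiff ℝ ∞ f)
    (hf' : HasCompactSupport f) {h : EuclideanSpace ℝ ι → ℝ≥0∞}
    (hh : ∀ x y, ‖x‖ ≤ ‖y‖ → h x ≤ h y) (x : ι → ℝ) (i : ι) :
    h (WithLp.toLp 2 x) * ‖f (WithLp.toLp 2 x)‖ₑ ≤
      ∫⁻ t, h (WithLp.toLp 2 (Function.update x i t)) *
        ‖partialD i f (WithLp.toLp 2 (Function.update x i t))‖ₑ := by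
  have hemb : Topology.IsClosedEmbedding
      fun t : ℝ => (WithLp.toLp 2 (Function.update x i t) : EuclideanSpace ℝ ι) :=
    (PiLp.homeomorph 2 (fun _ : ι => ℝ)).symm.isClosedEmbedding.comp
      (isClosedEmbedding_update x i)
  have := mul_enorm_le_lintegral_deriv
    (g := fun t => f (WithLp.toLp 2 (Function.update x i t)))
    ((hf.comp (contDiff_toLp_update x i)).of_le (by simp)) (hf'.comp_isClosedEmbedding hemb)
    (fun t => h (WithLp.toLp 2 (Function.update x i t))) (x i) (fun t ht => hh _ _ ?_)
  · simpa only [deriv_comp_toLp_update hf, Function.update_eq_self] using this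
  · simp only [Function.update_eq_self, EuclideanSpace.norm_eq]
    refine Real.sqrt_le_sqrt (Finset.sum_le_sum fun j _ => ?_)
    rcases eq_or_ne j i with rfl | hj
    · simp only [Function.update_self, Real.norm_eq_abs]
      gcongr
    · simp [Function.update_of_ne hj]

/-- The one-coordinate estimate is iterated over all coordinates, each differentiated and integrated
once, as marginal integrals. -/
theorem mul_enorm_le_lintegral_multiD {f : EuclideanSpace ℝ ι → ℝ} (hf : ContDiff ℝ ∞ f)
    (hf' : HasCompactSupport f) {h : EuclideanSpace ℝ ι → ℝ≥0∞} (hm : Measurable h)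
    (hh : ∀ x y, ‖x‖ ≤ ‖y‖ → h x ≤ h y) (x : EuclideanSpace ℝ ι) :
    h x * ‖f x‖ₑ ≤ ∫⁻ y, h y * ‖multiD (fun _ => 1) f y‖ₑ := by
  have key : ∀ l : List ι, l.Nodup →
      let D := l.foldr (fun i g => (partialD i)^[1] g) f
      (ContDiff ℝ ∞ D ∧ HasCompactSupport D) ∧
      (fun x : ι → ℝ => h (WithLp.toLp 2 x) * ‖f (WithLp.toLp 2 x)‖ₑ) ≤
        ∫⋯∫⁻_l.toFinset, (fun x : ι → ℝ => h (WithLp.toLp 2 x) * ‖D (WithLp.toLp 2 x)‖ₑ)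
          ∂(fun _ => volume) := by
    intro l
    induction l with
    | nil => exact fun _ => ⟨⟨hf, hf'⟩, by simp⟩
    | cons i l ih =>
      intro hl
      obtain ⟨hil, hl'⟩ := List.nodup_cons.1 hl
      obtain ⟨⟨h1, h2⟩, h3⟩ := ih hl'
      simp only [List.foldr_cons, Function.iterate_one] at h1 h2 h3 ⊢
      set D := l.foldr (fun i g => partialD i g) f
      refine ⟨⟨contDiff_partialD i h1, hasCompactSupport_partialD i h2⟩, ?_⟩
      have hmeas : Measurable fun x : ι → ℝ =>
          h (WithLp.toLp 2 x) * ‖partialD i D (WithLp.toLp 2 x)‖ₑ :=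
        ((hm.mul (contDiff_partialD i h1).continuous.measurable.enorm).comp
          (PiLp.volume_preserving_toLp ι).measurable)
      rw [List.toFinset_cons, lmarginal_insert' _ hmeas (by simpa using hil)]
      exact h3.trans (lmarginal_mono fun x => mul_enorm_le_lintegral_partialD h1 h2 hh x i)
  have h1 := (key (Finset.univ : Finset ι).toList (Finset.nodup_toList _)).2 x.ofLp
  rw [Finset.toList_toFinset, lmarginal_univ] at h1
  rw [← (PiLp.volume_preserving_toLp ι).lintegral_comp_emb
    (MeasurableEquiv.toLp 2 (ι → ℝ)).measurableEmbedding]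
  exact h1

theorem sobolevNorm_nonneg (k : SobolevIndex ι) (f : TestSpace ι) : 0 ≤ sobolevNorm k f :=
  Real.sqrt_nonneg _

theorem lintegral_multiD_le_sobolevNorm (k : SobolevIndex ι) {β : ι → ℕ}
    (hβ : ∑ i, β i ≤ k.order) (f : TestSpace ι) :
    (∫⁻ r, ENNReal.ofReal (|multiD β f r| ^ 2 * k.weight r)) ≤
      ENNReal.ofReal (sobolevNorm k f) ^ 2 := by
  have hnn : ∀ β : ι → ℕ, ∀ r, 0 ≤ |multiD β f r| ^ 2 * k.weight r := fun β r =>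
    mul_nonneg (sq_nonneg _) (zero_le_one.trans (k.one_le r))
  have hint : Integrable fun r => |multiD β f r| ^ 2 * k.weight r :=
    (integrable_multiD_mul k β f f).congr (Filter.Eventually.of_forall fun r => by
      simp only [sq_abs]; ring)
  rw [← ofReal_integral_eq_lintegral_ofReal hint (Filter.Eventually.of_forall (hnn β)),
    ← ENNReal.ofReal_pow (sobolevNorm_nonneg k f), sobolevNorm,
    Real.sq_sqrt (Finset.sum_nonneg fun β _ => integral_nonneg (hnn β))]
  exact ENNReal.ofReal_le_ofReal (Finset.single_le_sum
    (f := fun β => ∫ r, |multiD β f r| ^ 2 * k.weight r)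
    (fun β _ => integral_nonneg (hnn β)) (mem_multiIndices.2 hβ))

/-- A weighted Sobolev embedding. -/
theorem exists_mul_enorm_le_sobolevNorm {G : ℝ → ℝ} (hG : Monotone G) (hG0 : ∀ t, 0 ≤ G t) :
    ∃ (k : SobolevIndex ι) (C : ℝ≥0∞), C ≠ ⊤ ∧ ∀ (f : TestSpace ι) (x : EuclideanSpace ℝ ι),
      ENNReal.ofReal (G ‖x‖) * ‖f x‖ₑ ≤ C * ENNReal.ofReal (sobolevNorm k f) := by
  -- With `v = (1 + ‖y‖)^p`, Cauchy–Schwarz splits `G |D|` as `v⁻¹ · (v G |D|)`. The first factor is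
  -- square integrable since `2p` exceeds the dimension; the second is controlled by a Sobolev
  -- weight `W ≥ (v G)²`.
  set p : ℕ := Module.finrank ℝ (EuclideanSpace ℝ ι) + 1 with hp
  obtain ⟨W, hW, hW1, hWG⟩ := exists_smooth_ge (ι := ι)
    (G := fun t => ((1 + |max t 0|) ^ p * G t) ^ 2) (by
      intro s t hst
      have h1 : |max s 0| ≤ |max t 0| := by
        rw [abs_of_nonneg (le_max_right _ _), abs_of_nonneg (le_max_right _ _)]
        exact max_le_max hst le_rfl
      have h2 := hG hst
      have h3 := hG0 s
      dsimp only
      gcongr)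
  set v : EuclideanSpace ℝ ι → ℝ := fun y => (1 + ‖y‖) ^ p with hv
  have hv0 : ∀ y, 0 < v y := fun y => by positivity
  have hWv : ∀ y, (v y * G ‖y‖) ^ 2 ≤ W y := by
    intro y
    simpa [hv] using hWG y
  have hvc : Continuous v := by fun_prop
  have hint : Integrable fun y => ((v y)⁻¹) ^ 2 := by
    refine (integrable_one_add_norm (E := EuclideanSpace ℝ ι) (μ := volume)
      (r := ((2 * p : ℕ) : ℝ)) ?_).congr (Filter.Eventually.of_forall fun y => ?_)
    · rw [hp]; push_cast
      linarith [(Nat.cast_nonneg (Module.finrank ℝ (EuclideanSpace ℝ ι)) :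
        (0 : ℝ) ≤ Module.finrank ℝ (EuclideanSpace ℝ ι))]
    · dsimp only
      rw [Real.rpow_neg (by positivity), Real.rpow_natCast, inv_pow, hv, ← pow_mul, mul_comm p 2]
  -- The mixed derivative, once in each coordinate, has order `card ι`.
  refine ⟨⟨Fintype.card ι, W, hW, hW1⟩,
    (∫⁻ y, ENNReal.ofReal ((v y)⁻¹) ^ (2 : ℝ)) ^ (1 / 2 : ℝ), ?_, fun f x => ?_⟩
  · refine ENNReal.rpow_ne_top_of_nonneg (by norm_num) ?_
    have := hint.lintegral_lt_top.ne
    simpa only [ENNReal.rpow_two, ← ENNReal.ofReal_pow (inv_nonneg.2 (hv0 _).le)] using this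
  set k : SobolevIndex ι := ⟨Fintype.card ι, W, hW, hW1⟩
  set D := multiD (fun _ => 1) f
  have hD : Continuous D := ((multiD_props _).1 f f.contDiff).continuous
  have hGm : Measurable fun y : EuclideanSpace ℝ ι => ENNReal.ofReal (G ‖y‖) :=
    (hG.measurable.comp measurable_norm).ennreal_ofReal
  refine (mul_enorm_le_lintegral_multiD (h := fun y => ENNReal.ofReal (G ‖y‖)) f.contDiff
    f.hasCompactSupport hGm (fun x y hxy => ENNReal.ofReal_le_ofReal (hG hxy)) x).trans ?_
  calc ∫⁻ y, ENNReal.ofReal (G ‖y‖) * ‖D y‖ₑ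
      = ∫⁻ y, ((fun y => ENNReal.ofReal ((v y)⁻¹)) *
          (fun y => ENNReal.ofReal (v y) * (ENNReal.ofReal (G ‖y‖) * ‖D y‖ₑ))) y := by
        refine lintegral_congr fun y => ?_
        rw [Pi.mul_apply, ← mul_assoc, ← ENNReal.ofReal_mul (inv_nonneg.2 (hv0 y).le),
          inv_mul_cancel₀ (hv0 y).ne', ENNReal.ofReal_one, one_mul]
    _ ≤ (∫⁻ y, ENNReal.ofReal ((v y)⁻¹) ^ (2 : ℝ)) ^ (1 / 2 : ℝ) *
          (∫⁻ y, (ENNReal.ofReal (v y) * (ENNReal.ofReal (G ‖y‖) * ‖D y‖ₑ)) ^ (2 : ℝ)) ^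
            (1 / 2 : ℝ) := by
        refine ENNReal.lintegral_mul_le_Lp_mul_Lq _ Real.HolderConjugate.two_two ?_ ?_
        · exact (hvc.measurable.inv.ennreal_ofReal).aemeasurable
        · exact (hvc.measurable.ennreal_ofReal.mul
            (hGm.mul hD.measurable.enorm)).aemeasurable
    _ ≤ _ := by
        gcongr
        rw [one_div, ENNReal.rpow_inv_le_iff (by norm_num), ENNReal.rpow_two]
        refine le_trans (lintegral_mono fun y => ?_)
          (lintegral_multiD_le_sobolevNorm k (β := fun _ => 1) (by simp [k]) f)
        rw [ENNReal.rpow_two, Real.enorm_eq_ofReal_abs, ← ENNReal.ofReal_mul (hG0 _),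
          ← ENNReal.ofReal_mul (hv0 y).le, ← ENNReal.ofReal_pow
            (mul_nonneg (hv0 y).le (mul_nonneg (hG0 _) (abs_nonneg _)))]
        refine ENNReal.ofReal_le_ofReal ?_
        calc (v y * (G ‖y‖ * |D y|)) ^ 2 = |D y| ^ 2 * (v y * G ‖y‖) ^ 2 := by ring
          _ ≤ |D y| ^ 2 * W y := by gcongr; exact hWv y

theorem exists_abs_integral_le_sobolevNorm (μ : Measure (EuclideanSpace ℝ ι))
    [IsFiniteMeasureOnCompacts μ] : ∃ (k : SobolevIndex ι) (C : NNReal), ∀ f : TestSpace ι,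
      |∫ r, f r ∂μ| ≤ C * sobolevNorm k f := by
  obtain ⟨G, hG, hG0, hGint⟩ := exists_lintegral_inv_ne_top μ
  obtain ⟨k, C, hC, hbound⟩ := exists_mul_enorm_le_sobolevNorm (ι := ι) hG fun t => (hG0 t).le
  set A := C * ∫⁻ x, (ENNReal.ofReal (G ‖x‖))⁻¹ ∂μ with hA
  have hA' : A ≠ ⊤ := ENNReal.mul_ne_top hC hGint
  refine ⟨k, A.toNNReal, fun f => ?_⟩
  have h1 : ENNReal.ofReal |∫ r, f r ∂μ| ≤ A * ENNReal.ofReal (sobolevNorm k f) := by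
    rw [← Real.enorm_eq_ofReal_abs]
    refine (enorm_integral_le_lintegral_enorm _).trans ?_
    calc ∫⁻ r, ‖f r‖ₑ ∂μ
        ≤ ∫⁻ r, C * ENNReal.ofReal (sobolevNorm k f) * (ENNReal.ofReal (G ‖r‖))⁻¹ ∂μ := by
          refine lintegral_mono fun r => ?_
          rw [← div_eq_mul_inv, ENNReal.le_div_iff_mul_le
            (Or.inl (ENNReal.ofReal_pos.2 (hG0 _)).ne') (Or.inl ENNReal.ofReal_ne_top), mul_comm]
          exact hbound f r
      _ = A * ENNReal.ofReal (sobolevNorm k f) := by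
          rw [lintegral_const_mul' _ _ (ENNReal.mul_ne_top hC ENNReal.ofReal_ne_top), hA]
          ring
  have h2 := ENNReal.toReal_mono (ENNReal.mul_ne_top hA' ENNReal.ofReal_ne_top) h1
  rwa [ENNReal.toReal_mul, ENNReal.toReal_ofReal (abs_nonneg _),
    ENNReal.toReal_ofReal (sobolevNorm_nonneg k f)] at h2

theorem withSeminorms_sobolevFamily : WithSeminorms (sobolevFamily ι) := ⟨rfl⟩

/-- Integration against a Radon measure, as an element of `𝒟'(ℝ^ι)`. -/
noncomputable def integralCLM (μ : Measure (EuclideanSpace ℝ ι)) [IsFiniteMeasureOnCompacts μ] :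
    TestSpace ι →L[ℝ] ℝ where
  toFun f := ∫ r, f r ∂μ
  map_add' f g := integral_add (f.integrable μ) (g.integrable μ)
  map_smul' c f := integral_const_mul c _
  cont := by
    let T : TestSpace ι →ₗ[ℝ] ℝ :=
      { toFun := fun f => ∫ r, f r ∂μ
        map_add' := fun f g => integral_add (f.integrable μ) (g.integrable μ)
        map_smul' := fun c f => integral_const_mul c _ }
    obtain ⟨k, C, hC⟩ := exists_abs_integral_le_sobolevNorm μ
    refine withSeminorms_sobolevFamily.continuous_real_rng T ⟨{k}, C, fun f => ?_⟩
    rw [Finset.sup_singleton]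
    exact (le_abs_self _).trans (hC f)

end

/-- The sequence of functionals given by a sequence of Radon measures. -/
noncomputable def RadonSeq.toDistSeq {d : ℕ} (m : RadonSeq d) : DistSeq d where
  toFun n :=
    haveI : IsFiniteMeasureOnCompacts (m.toMeasure n) := ⟨fun K => m.finite_on_compacts n K⟩
    integralCLM (m.toMeasure n)
  symm n σ f := by
    change ∫ r, f (permuteVars d σ r) ∂(m.toMeasure n) = ∫ r, f r ∂(m.toMeasure n)
    conv_rhs => rw [← m.symm n σ]
    exact ((permuteVars d σ).toHomeomorph.measurableEmbedding.integral_map _).symm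

theorem RadonSeq.toDistSeq_isGivenBy {d : ℕ} (m : RadonSeq d) : m.toDistSeq.IsGivenBy m :=
  fun _ _ => rfl

/-! ### The determining set -/

theorem multiD_zero {ι : Type} [Fintype ι] [DecidableEq ι] (f : EuclideanSpace ℝ ι → ℝ) :
    multiD (fun _ => 0) f = f := by
  simp [multiD]

section
variable {d : ℕ}

theorem AdmissibleWeights.le_sqrt {k kt : ℕ → EuclideanSpace ℝ (Fin d) → ℝ}
    (hk : AdmissibleWeights k kt) {n : ℕ} (hn : 1 ≤ n) (r : EuclideanSpace ℝ (Fin d)) :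
    k n r ≤ Real.sqrt (kt n r) := by
  have h := hk.le_tilde n hn (fun _ => 0) (by simp) r
  rw [multiD_zero, sq_abs] at h
  exact Real.le_sqrt_of_sq_le h

theorem ofReal_sqrt_le_weightSup {n : ℕ} (w : EuclideanSpace ℝ (Fin d) → ℝ)
    {r : EuclideanSpace ℝ (Fin d)} (hr : ‖r‖ ≤ n) :
    ENNReal.ofReal (Real.sqrt (w r)) ≤ weightSup n w := by
  refine le_trans (le_of_eq ?_) (le_iSup₂_of_le r hr (le_iSup₂ (f := fun
    (x : EuclideanSpace ℝ (Fin d)) (_ : ∀ i, x i ∈ Set.Icc (-1 : ℝ) 1) =>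
    ENNReal.ofReal (Real.sqrt (w (r + x)))) 0 (by simp)))
  rw [add_zero]

theorem weightSup_ne_top (n : ℕ) {w : EuclideanSpace ℝ (Fin d) → ℝ} (hw : Continuous w) :
    weightSup n w ≠ ⊤ := by
  obtain ⟨C, hC⟩ := (isCompact_closedBall (0 : EuclideanSpace ℝ (Fin d))
    (n + Real.sqrt d)).bddAbove_image (f := fun r => Real.sqrt (w r)) (by fun_prop)
  refine ne_top_of_le_ne_top (ENNReal.ofReal_ne_top (r := C)) (iSup₂_le fun z hz =>
    iSup₂_le fun x hx => ENNReal.ofReal_le_ofReal (hC ⟨z + x, ?_, rfl⟩))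
  have hx' : ‖x‖ ≤ Real.sqrt d := by
    rw [EuclideanSpace.norm_eq]
    refine Real.sqrt_le_sqrt ?_
    calc ∑ i, ‖x i‖ ^ 2 ≤ ∑ _i : Fin d, (1 : ℝ) := by
          refine Finset.sum_le_sum fun i _ => ?_
          rw [Real.norm_eq_abs]
          exact pow_le_one₀ (abs_nonneg _) (abs_le.2 (hx i))
      _ = d := by simp
  rw [mem_closedBall_zero_iff]
  exact (norm_add_le _ _).trans (add_le_add hz hx')

/-- The test functions `f` with `sup |f| k^{(2n)} ≤ weightSup n k̃^{(2n)}` for all `n ≥ 1`. -/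
def dominatedTestFunctions (k kt : ℕ → EuclideanSpace ℝ (Fin d) → ℝ) : Set (TestSpace (Fin d)) :=
  {f | ∀ n ≥ 1, ∀ r, ENNReal.ofReal (|f r| * k (2 * n) r) ≤ weightSup n (kt (2 * n))}

variable {k kt : ℕ → EuclideanSpace ℝ (Fin d) → ℝ}

theorem exists_smul_mem_dominatedTestFunctions (hk : AdmissibleWeights k kt)
    (f : TestSpace (Fin d)) : ∃ c : ℝ, c ≠ 0 ∧ c • f ∈ dominatedTestFunctions k kt := by
  have hbdd : ∀ w : EuclideanSpace ℝ (Fin d) → ℝ, Continuous w →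
      ∃ C, 0 ≤ C ∧ ∀ r, |f r| * w r ≤ C := by
    intro w hw
    obtain ⟨C, hC⟩ := (f.hasCompactSupport.mul_right (f' := w)).exists_bound_of_continuous
      (f.contDiff.continuous.mul hw)
    refine ⟨C, (norm_nonneg _).trans (hC 0), fun r => le_trans ?_ (hC r)⟩
    rw [Pi.mul_apply, norm_mul, Real.norm_eq_abs, Real.norm_eq_abs]
    gcongr
    exact le_abs_self _
  obtain ⟨C, hC0, hC⟩ := hbdd (fun _ => 1) continuous_const
  choose! D hD0 hD using fun (n : ℕ) (hn : 1 ≤ n) =>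
    hbdd (k (2 * n)) (hk.smooth (2 * n) (by omega)).continuous
  obtain ⟨R, hR⟩ := f.hasCompactSupport.isCompact.isBounded.subset_closedBall 0
  obtain ⟨N, hN⟩ := exists_nat_ge R
  -- The constant dominates `|f|` itself and `|f| k^{(2n)}` for the finitely many `n ≤ N`, where the
  -- support may leave the ball of radius `n`.
  set c := 1 + C + ∑ n ∈ Finset.Icc 1 N, D n with hc
  have hsum : 0 ≤ ∑ n ∈ Finset.Icc 1 N, D n :=
    Finset.sum_nonneg fun n hn => hD0 n (Finset.mem_Icc.1 hn).1
  have hc0 : 0 < c := by linarith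
  refine ⟨c⁻¹, (inv_pos.2 hc0).ne', fun n hn r => ?_⟩
  have hk1 : 1 ≤ k (2 * n) r := hk.one_le (2 * n) (by omega) r
  have hval : |(c⁻¹ • f : TestSpace (Fin d)) r| = c⁻¹ * |f r| := by
    rw [TestSpace.coe_smul, Pi.smul_apply, smul_eq_mul, abs_mul, abs_of_pos (inv_pos.2 hc0)]
  rw [hval]
  by_cases hnN : n ≤ N
  -- For `n ≤ N` it suffices to get below `1`, because `1 ≤ k ≤ √k̃` at the origin bounds
  -- `weightSup` from below.
  · refine le_trans (ENNReal.ofReal_le_ofReal ?_)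
      (ofReal_sqrt_le_weightSup (kt (2 * n)) (r := 0) (by simp))
    refine le_trans ?_ ((hk.one_le (2 * n) (by omega) 0).trans (hk.le_sqrt (by omega) 0))
    rw [mul_assoc, inv_mul_le_iff₀ hc0, mul_one]
    have := Finset.single_le_sum (f := D) (fun n hn => hD0 n (Finset.mem_Icc.1 hn).1)
      (Finset.mem_Icc.2 ⟨hn, hnN⟩)
    linarith [hD n hn r]
  · by_cases hr : ‖r‖ ≤ n
    · refine le_trans (ENNReal.ofReal_le_ofReal ?_) (ofReal_sqrt_le_weightSup (kt (2 * n)) hr)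
      refine le_trans ?_ (hk.le_sqrt (by omega) r)
      refine mul_le_of_le_one_left (by linarith) ?_
      rw [inv_mul_le_iff₀ hc0, mul_one]
      linarith [hC r]
    · have hfr : f r = 0 := by
        by_contra h
        have h1 := mem_closedBall_zero_iff.1 (hR (subset_tsupport _ h))
        have h2 : (N : ℝ) ≤ n := by exact_mod_cast (by omega : N ≤ n)
        exact hr (h1.trans (hN.trans h2))
      simp [hfr]

theorem span_dominatedTestFunctions (hk : AdmissibleWeights k kt) :
    Submodule.span ℝ (dominatedTestFunctions k kt) = ⊤ := by
  refine Submodule.eq_top_iff'.2 fun f => ?_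
  obtain ⟨c, hc, hf⟩ := exists_smul_mem_dominatedTestFunctions hk f
  exact (Submodule.smul_mem_iff _ hc).1 (Submodule.subset_span hf)

theorem growth_dominatedTestFunctions_le (hk : AdmissibleWeights k kt) (m : RadonSeq d) (n : ℕ) :
    m.toDistSeq.growth (dominatedTestFunctions k kt) n ≤
      (weightSup n (kt (2 * n)) ^ (2 * n) * m.weightedIntegral (2 * n) (k (2 * n))) ^
        (1 / 2 : ℝ) := by
  refine ENNReal.rpow_le_rpow (iSup₂_le fun f hf => ?_) (by norm_num)
  rw [m.toDistSeq_isGivenBy, ← Real.enorm_eq_ofReal_abs]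
  refine (enorm_integral_le_lintegral_enorm _).trans ?_
  set S := weightSup n (kt (2 * n)) with hS
  by_cases hn : 1 ≤ n
  · have hS_top : S ≠ ⊤ := weightSup_ne_top n (hk.smooth_tilde (2 * n) (by omega)).continuous
    rw [RadonSeq.weightedIntegral, ← lintegral_const_mul' _ _ (ENNReal.pow_ne_top hS_top)]
    refine lintegral_mono fun r => ?_
    have hpos : ∀ r, 0 < k (2 * n) r := fun r =>
      zero_lt_one.trans_le (hk.one_le (2 * n) (by omega) r)
    change ‖∏ l, f l (block l r)‖ₑ ≤ _
    rw [one_div, ← Finset.prod_inv_distrib, ENNReal.ofReal_prod_of_nonneg fun l _ =>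
      (inv_pos.2 (hpos _)).le, Real.enorm_eq_ofReal_abs, Finset.abs_prod,
      ENNReal.ofReal_prod_of_nonneg fun l _ => abs_nonneg _]
    calc ∏ l, ENNReal.ofReal |f l (block l r)|
        ≤ ∏ l : Fin (2 * n), S * ENNReal.ofReal (k (2 * n) (block l r))⁻¹ := by
          refine Finset.prod_le_prod' fun l _ => ?_
          calc ENNReal.ofReal |f l (block l r)|
              = ENNReal.ofReal (|f l (block l r)| * k (2 * n) (block l r)) *
                  ENNReal.ofReal (k (2 * n) (block l r))⁻¹ := by
                rw [← ENNReal.ofReal_mul (mul_nonneg (abs_nonneg _) (hpos _).le),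
                  mul_inv_cancel_right₀ (hpos _).ne']
            _ ≤ _ := by gcongr; exact hf l n hn _
      _ = _ := by rw [Finset.prod_mul_distrib]; simp
  · obtain rfl : n = 0 := by omega
    -- At `n = 0` the weights are unconstrained and `S` may be infinite, but it enters only with
    -- exponent zero, and the empty tensor product is `1`.
    rw [show S ^ (2 * 0) = 1 from pow_zero S, one_mul]
    refine lintegral_mono fun r => ?_
    have : IsEmpty (Fin (2 * 0)) := Fin.isEmpty
    change ‖∏ l, f l (block l r)‖ₑ ≤ ENNReal.ofReal (1 / ∏ l, k (2 * 0) (block l r))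
    simp

theorem isDetermining_toDistSeq (m : RadonSeq d) (hk : AdmissibleWeights k kt)
    (hCarleman : m.WeightedCarleman k kt)
    (hfinite : ∀ n : ℕ, m.weightedIntegral (2 * n) (k (2 * n)) < ⊤) :
    m.toDistSeq.IsDetermining := by
  have hgrowth := growth_dominatedTestFunctions_le hk m
  have hfin : ∀ n, m.toDistSeq.growth (dominatedTestFunctions k kt) n < ⊤ := by
    intro n
    refine (hgrowth n).trans_lt (ENNReal.rpow_lt_top_of_nonneg (by norm_num)
      (ENNReal.mul_ne_top ?_ (hfinite n).ne))
    rcases Nat.eq_zero_or_pos n with rfl | hn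
    · simp
    · exact ENNReal.pow_ne_top
        (weightSup_ne_top n (hk.smooth_tilde (2 * n) (by omega)).continuous)
  refine ⟨dominatedTestFunctions k kt, ?_, hfin, ?_⟩
  · rw [span_dominatedTestFunctions hk]; exact dense_univ
  refine isQuasiAnalytic_of_tsum_eq_top (fun n => ENNReal.toReal_nonneg) (top_le_iff.1 ?_)
  rw [← show _ = ⊤ from hCarleman, tsum_pnat_eq_tsum_succ (f := fun n : ℕ =>
    (weightSup n (kt (2 * n)) *
      m.weightedIntegral (2 * n) (k (2 * n)) ^ (1 / (2 * (n : ℝ))))⁻¹)]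
  -- Termwise comparison in `[0, ∞]`, where `0⁻¹ = ⊤` also covers vanishing denominators. The root
  -- `1/(n+1)` of the growth bound turns the power `2(n+1)` of `weightSup` into `1`.
  refine ENNReal.tsum_le_tsum fun n => ENNReal.inv_le_inv.2 ?_
  have hn : (0 : ℝ) < (n : ℝ) + 1 := by positivity
  rw [← ENNReal.ofReal_rpow_of_nonneg ENNReal.toReal_nonneg (by positivity),
    ENNReal.ofReal_toReal (hfin _).ne]
  refine (ENNReal.rpow_le_rpow (hgrowth (n + 1)) (by positivity)).trans_eq ?_
  rw [← ENNReal.rpow_mul, ENNReal.mul_rpow_of_nonneg _ _ (by positivity), ← ENNReal.rpow_natCast,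
    ← ENNReal.rpow_mul]
  have h1 : ((2 * (n + 1) : ℕ) : ℝ) * (1 / 2 * (1 / ((n : ℝ) + 1))) = 1 := by
    push_cast; field_simp
  have h2 : (1 / 2 * (1 / ((n : ℝ) + 1)) : ℝ) = 1 / (2 * ((n + 1 : ℕ) : ℝ)) := by
    push_cast; field_simp
  rw [h1, h2, ENNReal.rpow_one]

end

end MomentProblem

theorem proposition4p4 (d : ℕ) (m : MomentProblem.RadonSeq d)
    (k kt : ℕ → EuclideanSpace ℝ (Fin d) → ℝ)
    (hk : MomentProblem.AdmissibleWeights k kt)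
    (hCarleman : m.WeightedCarleman k kt)
    (hfinite : ∀ n : ℕ, m.weightedIntegral (2 * n) (k (2 * n)) < ⊤) :
    ∃ T : MomentProblem.DistSeq d, T.IsGivenBy m ∧ T.IsDetermining :=
  ⟨m.toDistSeq, m.toDistSeq_isGivenBy,
    MomentProblem.isDetermining_toDistSeq m hk hCarleman hfinite⟩
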